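/- **Theorem 1.2 (Blow-up).** Let $\sigma\ge 1$ and $\delta\in[0,\sigma)$ be real numbers (possibly fractional), put $k^-:=\min\{\sigma,2\delta\}$, and let $n\in\mathbb N$ satisfy $n>2k^-$. Let $$1<p<1+\frac{2\sigma}{n-k^-},$$ and let $u_1\in L^1(\mathbb R^n)$ be real-valued with $\int_{\mathbb R^n}u_1(x)\,dx>0$. Consider the Cauchy problem $$u_{tt}+(-\Delta)^\sigma u+(-\Delta)^\delta u_t=|u|^p,\qquad u(0,x)=u_0(x),\quad u_t(0,x)=u_1(x).\tag{1}$$ Here, for $\gamma\ge 0$, $(-\Delta)^\gamma$ acts on $H^{2\gamma}(\mathbb R^n)$ as the Fourier multiplier with symbol $|\xi|^{2\gamma}$ (for the Fourier transform with kernel $e^{-ix\cdot\xi}$), and $H^a$ is the $L^2$-based Bessel potential space. For $0<T\le\infty$, a *Sobolev solution* of (1) on $[0,T)$ is a (real- or complex-valued) function $u\in C([0,T),H^{2\sigma}(\mathbb R^n))$ with $|u|^p\in L^1_{\rm loc}([0,T)\times\mathbb R^n)$ such that for every real-valued $\phi\in C_c^\infty([0,T)\times\mathbb R^n)$ $$\int_0^T\!\!\int_{\mathbb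 R^n}\big(u\,\phi_{tt}+(-\Delta)^\sigma u\;\phi-(-\Delta)^\delta u\;\phi_t\big)\,dx\,dt=\int_0^T\!\!\int_{\mathbb R^n}|u|^p\phi\,dx\,dt+\int_{\mathbb R^n}u_1\,\phi(0,\cdot)\,dx+\int_{\mathbb R^n}\big((-\Delta)^\delta u_0\;\phi(0,\cdot)-u_0\,\phi_t(0,\cdot)\big)\,dx .$$ 1. With data $(u_0,u_1)=(0,u_1)$ there is no global (in time) Sobolev solution $u\in C([0,\infty),H^{2\sigma}(\mathbb R^n))$ of (1), that is, none on $[0,\infty)$. 2. For $\varepsilon>0$ let $T_\varepsilon\in[0,\infty]$ be the lifespan for the data $(0,\varepsilon u_1)$: the supremum of all $T$ such that (1) with these data has a Sobolev solution on $[0,T)$. There are constants $C>0$ and $\varepsilon_0>0$ (which may depend on $n,\sigma,\delta,p,u_1$) such that for all $\varepsilon\in(0,\varepsilon_0]$ $$T_\varepsilon\le C\,\varepsilon^{-\frac{(2\sigma-k^-)(p-1)}{2\sigma-(n-k^-)(p-1)}} .$$ -/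

import Mathlib

open MeasureTheory
open scoped FourierTransform SchwartzMap ContDiff

/-- The space `L²(ℝⁿ)` of complex-valued functions. -/
abbrev L2 (n : ℕ) : Type :=
  Lp (α := EuclideanSpace ℝ (Fin n)) ℂ 2 volume

/-- The parameter `k⁻ = min{σ, 2δ}`. -/
noncomputable def kMinus (σ δ : ℝ) : ℝ := min σ (2 * δ)

/-- The function `ξ ↦ (2π|ξ|)^(2γ) (𝓕 f)(ξ)`. In Mathlib's normalization of the Fourier transform,
`𝓕 f ξ = ∫ exp(-2πi⟨x, ξ⟩) f x dx`, the symbol of `-Δ` is `(2π|ξ|)²`. -/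
noncomputable def fracSymbolMul {n : ℕ} (γ : ℝ) (f : L2 n) : EuclideanSpace ℝ (Fin n) → ℂ :=
  fun ξ => (((2 * Real.pi * ‖ξ‖) ^ (2 * γ) : ℝ) : ℂ) * (𝓕 f : L2 n) ξ

open Classical in
/-- The fractional Laplacian `(-Δ)^γ`, `γ ≥ 0`, as an operator in `L²(ℝⁿ)` with domain
`H^{2γ}(ℝⁿ)`: `(-Δ)^γ f = 𝓕⁻¹ ((2π|ξ|)^(2γ) 𝓕 f)`. Outside of the domain the value is `0`. -/
noncomputable def fracLaplacian {n : ℕ} (γ : ℝ) (f : L2 n) : L2 n :=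
  if h : MemLp (fracSymbolMul γ f) 2 volume then 𝓕⁻ (h.toLp (fracSymbolMul γ f)) else 0

/-- The time interval `[0, T)`, where `T = ⊤` gives `[0, ∞)`. -/
def timeInterval (T : EReal) : Set ℝ := {t : ℝ | 0 ≤ t ∧ (t : EReal) < T}

/-- `u ∈ C([0, T), H^s(ℝⁿ))`: for `t ∈ [0, T)` the Bessel potential of order `s` of `u t` is an
`L²` function (that is, `u t` lies in the Bessel potential space `H^s`), and it depends
continuously on `t` in `L²` (that is, `u` is continuous for the norm of `H^s`). -/
def ContinuousInSobolev {n : ℕ} (s : ℝ) (T : EReal) (u : ℝ → L2 n) : Prop :=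
  ∃ v : ℝ → L2 n, ContinuousOn v (timeInterval T) ∧
    ∀ t ∈ timeInterval T,
      TemperedDistribution.besselPotential (EuclideanSpace ℝ (Fin n)) ℂ s
        (Lp.toTemperedDistribution (u t)) = Lp.toTemperedDistribution (v t)

/-- `|u|^p ∈ L¹_loc([0, T) × ℝⁿ)`. -/
def LocallyIntegrablePower {n : ℕ} (p : ℝ) (T : EReal) (u : ℝ → L2 n) : Prop :=
  ∀ (b : ℝ) (K : Set (EuclideanSpace ℝ (Fin n))), (b : EReal) < T → IsCompact K →
    ∫⁻ t in Set.Icc 0 b, ∫⁻ x in K, ‖u t x‖ₑ ^ p < ⊤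

/-- A test function `φ = φ(t, x)`: smooth, with compact support in `{t < T} × ℝⁿ`. It need not
vanish at `t = 0`. -/
structure IsTestFunction {n : ℕ} (T : EReal) (φ : ℝ × EuclideanSpace ℝ (Fin n) → ℝ) : Prop where
  smooth : ContDiff ℝ ∞ φ
  compact_support : HasCompactSupport φ
  support_lt : ∀ z ∈ tsupport φ, (z.1 : EReal) < T

/-- The first time derivative `∂ₜ φ(t, x)`. -/
noncomputable def timeDeriv {n : ℕ} (φ : ℝ × EuclideanSpace ℝ (Fin n) → ℝ)
    (t : ℝ) (x : EuclideanSpace ℝ (Fin n)) : ℝ :=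
  deriv (fun s => φ (s, x)) t

/-- The second time derivative `∂ₜ² φ(t, x)`. -/
noncomputable def timeDeriv₂ {n : ℕ} (φ : ℝ × EuclideanSpace ℝ (Fin n) → ℝ)
    (t : ℝ) (x : EuclideanSpace ℝ (Fin n)) : ℝ :=
  iteratedDeriv 2 (fun s => φ (s, x)) t

/-- `u` is a Sobolev solution on `[0, T)` of the Cauchy problem
`u_tt + (-Δ)^σ u + (-Δ)^δ u_t = |u|^p`, `u(0, x) = u₀(x)`, `u_t(0, x) = u₁(x)`:
it lies in `C([0, T), H^{2σ})`, its power `|u|^p` is locally integrable, and the equation holds with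
the initial data after multiplication by any test function `φ` and partial integration in `t`,
```
∫∫ (u φ_tt + (-Δ)^σ u φ - (-Δ)^δ u φ_t) dx dt
  = ∫∫ |u|^p φ dx dt + ∫ u₁ φ(0) dx + ∫ ((-Δ)^δ u₀ φ(0) - u₀ φ_t(0)) dx.
```
-/
structure IsSobolevSolution {n : ℕ} (σ δ p : ℝ) (T : EReal) (u₀ : L2 n)
    (u₁ : EuclideanSpace ℝ (Fin n) → ℂ) (u : ℝ → L2 n) : Prop where
  continuous_sobolev : ContinuousInSobolev (2 * σ) T u
  locallyIntegrable_power : LocallyIntegrablePower p T u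
  equation : ∀ φ : ℝ × EuclideanSpace ℝ (Fin n) → ℝ, IsTestFunction T φ →
    (∫ t in Set.Ioi (0 : ℝ), ∫ x,
        (u t x * (timeDeriv₂ φ t x : ℂ) + fracLaplacian σ (u t) x * (φ (t, x) : ℂ)
          - fracLaplacian δ (u t) x * (timeDeriv φ t x : ℂ)))
      = (∫ t in Set.Ioi (0 : ℝ), ∫ x, ((‖u t x‖ ^ p * φ (t, x) : ℝ) : ℂ))
        + (∫ x, u₁ x * (φ (0, x) : ℂ))
        + ∫ x, (fracLaplacian δ u₀ x * (φ (0, x) : ℂ) - u₀ x * (timeDeriv φ 0 x : ℂ))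

/-- The lifespan of Sobolev solutions to given data: the supremum of all `T` such that there is a
Sobolev solution on `[0, T)`. -/
noncomputable def lifespan {n : ℕ} (σ δ p : ℝ) (u₀ : L2 n)
    (u₁ : EuclideanSpace ℝ (Fin n) → ℂ) : EReal :=
  sSup {T : EReal | ∃ u : ℝ → L2 n, IsSobolevSolution σ δ p T u₀ u₁ u}

/-! The proof is the test function method with a slowly decaying weight. The operators `(-Δ)^σ` and
`(-Δ)^δ` are nonlocal, so for a compactly supported space factor φ there is no pointwise bound of
`(-Δ)^γ φ` by φ. For a smooth positive ψ comparable to `(1 + |x|)^(-r)` there is a substitute: if `n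
< r ≤ n + 2γ`, then `|∫ (-Δ)^γ v · ψ(x/R) dx| ≤ C R^(-2γ) ∫ |v| ψ(x/R) dx`. One exponent r serves
both operators.

For real γ > 0 this bound comes from writing a multiple of `(2π|ξ|)^(2γ)` as `∫ |y|^(-n-2γ) (2 - 2
cos(2π⟨y, ξ⟩))^M dy` with an integer M > γ (`exists_symbolIntegral_eq`). The power of `2 - 2 cos` is
the symbol of a central difference of order 2M. Plancherel and Fubini move that difference onto the
test function (`enorm_inner_fracLaplacian_le`). A pointwise estimate of the differences of ψ against
the kernel (`IsSmoothWeight.lintegral_rieszKernel_mul_centralDiff_le`) and scaling finish the bound.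

Now test the equation with `η(t) ψ(x/R)`, where η lives on the time scale `τ = R^(2σ - k⁻)` and its
derivatives are controlled by `η^(1/p)`. Every linear term is at most `A R^(-2σ) ∫ |u| η^(1/p)
ψ(x/R)`. Young's inequality absorbs `∫∫ |u|^p η ψ(x/R)`, so `ε ∫ u₁ ψ(x/R) ≤ N R^(n + 2σ - k⁻ -
2σp')` for data `ε u₁`, with p' the conjugate exponent of p
(`IsSobolevSolution.integral_data_mul_le`, `exists_integral_data_mul_le`). The exponent of R is
`-(2σ - (n - k⁻)(p - 1))/(p - 1)`, negative exactly for subcritical p, while the integral on the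
left tends to `ψ(0) ∫ u₁ > 0`. Solving for τ bounds every existence time. This contains both claims.

Since ψ is not compactly supported, it is approximated from below by cutoffs. The absorption needs a
finite power integral, which follows from the L² bounds on u, `(-Δ)^σ u` and `(-Δ)^δ u` over `[0,
τ]`. -/

set_option linter.unusedSectionVars false

/-! ### Polynomial weights and Peetre-type inequalities -/

section PolyWeight

variable {E : Type*} [NormedAddCommGroup E]

/-- The polynomially decaying weight `(1 + ‖x‖) ^ (-q)`. -/
noncomputable def polyWeight (q : ℝ) (x : E) : ℝ := (1 + ‖x‖) ^ (-q)

lemma polyWeight_pos (q : ℝ) (x : E) : 0 < polyWeight q x :=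
  Real.rpow_pos_of_pos (by positivity) _

lemma continuous_polyWeight (q : ℝ) : Continuous (polyWeight q : E → ℝ) := by
  unfold polyWeight
  refine Continuous.rpow_const (by fun_prop) fun x => Or.inl ?_
  positivity

lemma polyWeight_le_one {q : ℝ} (hq : 0 ≤ q) (x : E) : polyWeight q x ≤ 1 :=
  Real.rpow_le_one_of_one_le_of_nonpos (by linarith [norm_nonneg x]) (by linarith)

/-- Peetre's inequality. -/
lemma polyWeight_le_mul {q : ℝ} (hq : 0 ≤ q) (x y : E) :
    polyWeight q x ≤ (1 + ‖y - x‖) ^ q * polyWeight q y := by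
  have h1 : 1 + ‖y‖ ≤ (1 + ‖y - x‖) * (1 + ‖x‖) := by
    have : ‖y‖ ≤ ‖y - x‖ + ‖x‖ := by simpa using norm_add_le (y - x) x
    nlinarith [norm_nonneg x, norm_nonneg (y - x)]
  have h2 : (1 + ‖y‖) ^ q ≤ (1 + ‖y - x‖) ^ q * (1 + ‖x‖) ^ q := by
    rw [← Real.mul_rpow (by positivity) (by positivity)]
    exact Real.rpow_le_rpow (by positivity) h1 hq
  unfold polyWeight
  rw [Real.rpow_neg (by positivity), Real.rpow_neg (by positivity), ← div_eq_mul_inv,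
    inv_le_comm₀ (by positivity) (by positivity), inv_div, div_le_iff₀ (by positivity)]
  linarith

lemma polyWeight_le_of_norm_sub_le {q r : ℝ} (hq : 0 ≤ q) {x y : E} (h : ‖y - x‖ ≤ r) :
    polyWeight q x ≤ (1 + r) ^ q * polyWeight q y :=
  (polyWeight_le_mul hq x y).trans <| mul_le_mul_of_nonneg_right
    (Real.rpow_le_rpow (by positivity) (by linarith) hq) (polyWeight_pos q y).le

/-- Since `‖x‖ ≤ ‖x + k y‖ + m ‖y‖`, the larger of `‖y‖` and `‖x + k y‖` is at least `‖x‖ / (1 +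
m)`. The corresponding weight is bounded by the weight at x, and the other one survives to be
integrated in y. -/
lemma polyWeight_mul_le [NormedSpace ℝ E] {q m : ℝ} (hq : 0 ≤ q) {k : ℝ} (hk : |k| ≤ m) (x y : E) :
    polyWeight q y * polyWeight q (x + k • y) ≤
      (2 * (1 + m)) ^ q * polyWeight q x * (polyWeight q y + polyWeight q (x + k • y)) := by
  have key : ∀ z : E, 1 + ‖x‖ ≤ (2 * (1 + m)) * (1 + ‖z‖) →
      polyWeight q z ≤ (2 * (1 + m)) ^ q * polyWeight q x := by
    intro z hz
    have hm : 0 ≤ m := (abs_nonneg k).trans hk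
    have h2 := Real.rpow_le_rpow (by positivity) hz hq
    rw [Real.mul_rpow (by positivity) (by positivity)] at h2
    unfold polyWeight
    rw [Real.rpow_neg (by positivity), Real.rpow_neg (by positivity), ← div_eq_mul_inv,
      inv_le_comm₀ (by positivity) (by positivity), inv_div, div_le_iff₀ (by positivity)]
    linarith
  have hx : ‖x‖ ≤ ‖x + k • y‖ + m * ‖y‖ := by
    have h1 : ‖x‖ ≤ ‖x + k • y‖ + ‖k • y‖ := by simpa using norm_sub_le (x + k • y) (k • y)
    rw [norm_smul, Real.norm_eq_abs] at h1
    nlinarith [norm_nonneg y]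
  have hm : 0 ≤ m := (abs_nonneg k).trans hk
  have p1 := polyWeight_pos q y
  have p2 := polyWeight_pos q (x + k • y)
  have p0 := polyWeight_pos q x
  have p3 : 0 ≤ (2 * (1 + m)) ^ q * polyWeight q x := by positivity
  rcases le_total ‖y‖ ‖x + k • y‖ with h | h
  · have := key (x + k • y) (by nlinarith [norm_nonneg y, norm_nonneg (x + k • y)])
    nlinarith
  · have := key y (by nlinarith [norm_nonneg y, norm_nonneg (x + k • y)])
    nlinarith

end PolyWeight

/-! ### Central differences and their Fourier symbol -/

section CentralDiff

/-- The coefficients of the central difference of order `2 * M`, with the sign that makes the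
Fourier symbol nonnegative. -/
noncomputable def centralDiffCoeff (M j : ℕ) : ℝ := (-1) ^ (j + M) * (2 * M).choose j

/-- The central difference of order `2 * M` with step `y`. -/
noncomputable def centralDiff {E F : Type*} [AddCommGroup E] [Module ℝ E] [AddCommGroup F]
    [Module ℝ F] (M : ℕ) (y : E) (f : E → F) (x : E) : F :=
  ∑ j ∈ Finset.range (2 * M + 1), centralDiffCoeff M j • f (x + ((j : ℝ) - M) • y)

/-- With `z = exp(iθ)` one has `2 - 2 cos θ = -(1 - z)² / z`. The M-th power is then expanded by the
binomial theorem for `(1 - z)^(2M)`. -/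
lemma sum_centralDiffCoeff_mul_exp (M : ℕ) (θ : ℝ) :
    ∑ j ∈ Finset.range (2 * M + 1),
      (centralDiffCoeff M j : ℂ) * Complex.exp ((((j : ℝ) - M) * θ : ℝ) * Complex.I) =
      (((2 - 2 * Real.cos θ) ^ M : ℝ) : ℂ) := by
  set z := Complex.exp (θ * Complex.I) with hz
  have hz0 : z ≠ 0 := Complex.exp_ne_zero _
  have h1 : ∀ j : ℕ, Complex.exp ((((j : ℝ) - M) * θ : ℝ) * Complex.I) = z ^ j * (z⁻¹) ^ M := by
    intro j
    rw [hz, ← Complex.exp_neg, ← Complex.exp_nat_mul, ← Complex.exp_nat_mul, ← Complex.exp_add]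
    congr 1
    push_cast
    ring
  have h2 : ((2 - 2 * Real.cos θ : ℝ) : ℂ) = -((1 - z) ^ 2 * z⁻¹) := by
    have h3 : (Real.cos θ : ℂ) = (z + z⁻¹) / 2 := by
      rw [Complex.ofReal_cos, Complex.cos, hz, ← Complex.exp_neg]
      ring_nf
    push_cast
    rw [← Complex.ofReal_cos, h3]
    field_simp
    ring
  rw [Complex.ofReal_pow, h2, neg_pow, mul_pow, ← pow_mul, sub_eq_neg_add, add_pow, Finset.sum_mul,
    Finset.mul_sum]
  refine Finset.sum_congr rfl fun j _ => ?_
  rw [h1, centralDiffCoeff]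
  push_cast
  rw [neg_pow z j, pow_add]
  simp only [one_pow]
  ring

lemma two_sub_two_mul_cos_nonneg (θ : ℝ) : 0 ≤ 2 - 2 * Real.cos θ := by
  linarith [Real.cos_le_one θ]

lemma two_sub_two_mul_cos_le_sq (θ : ℝ) : 2 - 2 * Real.cos θ ≤ θ ^ 2 := by
  linarith [Real.one_sub_sq_div_two_le_cos (x := θ)]

lemma two_sub_two_mul_cos_le_four (θ : ℝ) : 2 - 2 * Real.cos θ ≤ 4 := by
  linarith [Real.neg_one_le_cos θ]

variable {E : Type*} [NormedAddCommGroup E] [InnerProductSpace ℝ E] [FiniteDimensional ℝ E]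
  [MeasurableSpace E] [BorelSpace E]

/-- Under Fourier inversion the difference inserts the factor `(2 - 2 cos(2π⟨v, y⟩))^M ≤
(2π‖v‖‖y‖)^(2M)`, whose moment against the transform is finite. This gives vanishing of order 2M in
y, uniformly in the base point, without a Taylor expansion. -/
lemma SchwartzMap.exists_norm_centralDiff_le (ρ : 𝓢(E, ℂ)) (M : ℕ) :
    ∃ C : ℝ, 0 ≤ C ∧ ∀ y z : E, ‖centralDiff M y ρ z‖ ≤ C * ‖y‖ ^ (2 * M) := by
  set f : 𝓢(E, ℂ) := 𝓕 ρ with hf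
  have hρ : ∀ z, ρ z = ∫ v, Complex.exp (↑(2 * Real.pi * inner ℝ v z) * Complex.I) • f v := by
    intro z
    have h1 : (𝓕⁻ f : 𝓢(E, ℂ)) = ρ := by rw [hf]; exact FourierTransform.fourierInv_fourier_eq ρ
    rw [← Real.fourierInv_eq', ← SchwartzMap.fourierInv_coe, h1]
  refine ⟨∫ v, (2 * Real.pi) ^ (2 * M) * (‖v‖ ^ (2 * M) * ‖f v‖),
    integral_nonneg fun v => by positivity, fun y z => ?_⟩
  have hint : Integrable fun v => (2 * Real.pi) ^ (2 * M) * (‖v‖ ^ (2 * M) * ‖f v‖) :=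
    (f.integrable_pow_mul volume (2 * M)).const_mul _
  have hsum : centralDiff M y ρ z = ∫ v, Complex.exp (↑(2 * Real.pi * inner ℝ v z) * Complex.I) *
      (((2 - 2 * Real.cos (2 * Real.pi * inner ℝ v y)) ^ M : ℝ) : ℂ) * f v := by
    unfold centralDiff
    simp_rw [hρ]
    simp_rw [← integral_smul]
    rw [← integral_finsetSum]
    · refine integral_congr_ae (Filter.Eventually.of_forall fun v => ?_)
      simp only
      rw [← sum_centralDiffCoeff_mul_exp, Finset.mul_sum, Finset.sum_mul]
      refine Finset.sum_congr rfl fun j _ => ?_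
      rw [inner_add_right, inner_smul_right, mul_add, Complex.ofReal_add, add_mul, Complex.exp_add,
        Complex.real_smul, smul_eq_mul]
      ring_nf
    · intro j _
      refine Integrable.smul _ ?_
      refine f.integrable.norm.mono' (by fun_prop) (Filter.Eventually.of_forall fun v => ?_)
      rw [norm_smul, Complex.norm_exp_ofReal_mul_I, one_mul]
  rw [hsum, ← integral_mul_const]
  refine norm_integral_le_of_norm_le (hint.mul_const _) (Filter.Eventually.of_forall fun v => ?_)
  rw [norm_mul, norm_mul, Complex.norm_exp_ofReal_mul_I, one_mul, Complex.norm_real,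
    Real.norm_eq_abs, abs_of_nonneg (pow_nonneg (two_sub_two_mul_cos_nonneg _) _)]
  have h1 : (2 - 2 * Real.cos (2 * Real.pi * inner ℝ v y)) ^ M ≤
      (2 * Real.pi) ^ (2 * M) * ‖v‖ ^ (2 * M) * ‖y‖ ^ (2 * M) := by
    rw [← mul_pow, ← mul_pow, pow_mul]
    refine pow_le_pow_left₀ (two_sub_two_mul_cos_nonneg _) ?_ _
    refine (two_sub_two_mul_cos_le_sq _).trans ?_
    rw [← sq_abs]
    refine pow_le_pow_left₀ (abs_nonneg _) ?_ _
    rw [abs_mul, abs_of_pos Real.two_pi_pos, mul_assoc (2 * Real.pi) ‖v‖]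
    exact mul_le_mul_of_nonneg_left (abs_real_inner_le_norm v y) Real.two_pi_pos.le
  calc _ ≤ (2 * Real.pi) ^ (2 * M) * ‖v‖ ^ (2 * M) * ‖y‖ ^ (2 * M) * ‖f v‖ :=
        mul_le_mul_of_nonneg_right h1 (norm_nonneg _)
    _ = _ := by ring

end CentralDiff

/-! ### Smooth weights and the Riesz kernel -/

section SmoothWeight

variable {E : Type*} [NormedAddCommGroup E] [InnerProductSpace ℝ E] [FiniteDimensional ℝ E]
  [MeasurableSpace E] [BorelSpace E]

lemma MeasureTheory.lintegral_comp_const_smul {f : E → ENNReal} (hf : Measurable f) {r : ℝ}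
    (hr : r ≠ 0) : ∫⁻ y, f (r • y) =
      ENNReal.ofReal |(r ^ Module.finrank ℝ E)⁻¹| * ∫⁻ y, f y := by
  rw [← lintegral_map hf (measurable_const_smul r), Measure.map_addHaar_smul _ hr,
    lintegral_smul_measure, smul_eq_mul]

/-- `ψ` is smooth, comparable to the weight `(1 + ‖x‖) ^ (-q)`, and its central differences are
controlled by the same weight. -/
structure IsSmoothWeight (q : ℝ) (ψ : E → ℝ) : Prop where
  contDiff : ContDiff ℝ ∞ ψ
  le_mul : ∀ x, polyWeight q x ≤ 2 ^ q * ψ x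
  le : ∀ x, ψ x ≤ 2 ^ q * polyWeight q x
  centralDiff_le : ∀ M : ℕ, ∃ C : ℝ, 0 ≤ C ∧ ∀ x y : E, ‖y‖ ≤ 1 →
    |centralDiff M y ψ x| ≤ C * ‖y‖ ^ (2 * M) * polyWeight q x

/-- The weight is mollified by a bump ρ supported in the unit ball. By Peetre's inequality the
weight changes by a factor of at most `2^q` over unit distance, so mollification keeps its size.
Differences fall on ρ, where the Schwartz bound applies. -/
lemma exists_isSmoothWeight {q : ℝ} (hq : 0 ≤ q) : ∃ ψ : E → ℝ, IsSmoothWeight q ψ := by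
  let b : ContDiffBump (0 : E) := ⟨1 / 2, 1, by norm_num, by norm_num⟩
  set ρ : E → ℝ := b.normed volume with hρ
  have hρ0 : ∀ z, 0 ≤ ρ z := fun z => b.nonneg_normed z
  have hρs : ∀ z, 1 ≤ ‖z‖ → ρ z = 0 := by
    intro z hz
    rw [← Function.notMem_support, hρ, b.support_normed_eq]
    simpa [b] using hz
  have hρsm : ContDiff ℝ ∞ ρ := b.contDiff_normed
  have hρc : HasCompactSupport ρ := b.hasCompactSupport_normed
  have hρi : Integrable ρ := hρsm.continuous.integrable_of_hasCompactSupport hρc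
  have hρx : ∀ x, ∫ z, ρ (x - z) = 1 := by
    intro x
    rw [integral_sub_left_eq_self ρ volume x]
    exact b.integral_normed
  have hρxi : ∀ x, Integrable fun z => ρ (x - z) := fun x => hρi.comp_sub_left x
  have hwρ : ∀ x, Integrable fun z => polyWeight q z * ρ (x - z) := by
    intro x
    refine (hρxi x).mono' ?_ (Filter.Eventually.of_forall fun z => ?_)
    · exact ((continuous_polyWeight q).mul
        (hρsm.continuous.comp (continuous_const.sub continuous_id))).aestronglyMeasurable
    · rw [Real.norm_eq_abs, abs_of_nonneg (mul_nonneg (polyWeight_pos q z).le (hρ0 _))]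
      exact mul_le_of_le_one_left (hρ0 _) (polyWeight_le_one hq z)
  refine ⟨fun x => ∫ z, polyWeight q z * ρ (x - z), ?_, fun x => ?_, fun x => ?_, fun M => ?_⟩
  · exact HasCompactSupport.contDiff_convolution_right (n := ⊤) (ContinuousLinearMap.mul ℝ ℝ) hρc
      (continuous_polyWeight q).locallyIntegrable hρsm
  · rw [← integral_const_mul]
    calc polyWeight q x = ∫ z, polyWeight q x * ρ (x - z) := by rw [integral_const_mul, hρx, mul_one]
      _ ≤ _ := by
        refine integral_mono ((hρxi x).const_mul _) ((hwρ x).const_mul _) fun z => ?_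
        rcases le_or_gt 1 ‖x - z‖ with h | h
        · simp [hρs _ h]
        · simp only
          rw [← mul_assoc]
          refine mul_le_mul_of_nonneg_right ?_ (hρ0 _)
          have := polyWeight_le_of_norm_sub_le (r := 1) hq (x := x) (y := z)
            (by rw [norm_sub_rev]; exact h.le)
          norm_num at this ⊢
          exact this
  · calc _ ≤ ∫ z, 2 ^ q * polyWeight q x * ρ (x - z) := by
          refine integral_mono (hwρ x) ((hρxi x).const_mul _) fun z => ?_
          rcases le_or_gt 1 ‖x - z‖ with h | h
          · simp [hρs _ h]
          · simp only
            refine mul_le_mul_of_nonneg_right ?_ (hρ0 _)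
            have := polyWeight_le_of_norm_sub_le (r := 1) hq (x := z) (y := x) h.le
            norm_num at this ⊢
            exact this
      _ = _ := by rw [integral_const_mul, hρx, mul_one]
  · have hc₁ : HasCompactSupport (Complex.ofRealCLM ∘ ρ) := hρc.comp_left rfl
    have hc₂ : ContDiff ℝ ∞ (Complex.ofRealCLM ∘ ρ) := by fun_prop
    obtain ⟨C, hC0, hC⟩ := (hc₁.toSchwartzMap hc₂).exists_norm_centralDiff_le M
    have hC' : ∀ y z : E, |centralDiff M y ρ z| ≤ C * ‖y‖ ^ (2 * M) := by
      intro y z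
      refine le_trans (le_of_eq ?_) (hC y z)
      rw [← Real.norm_eq_abs, ← Complex.norm_real]
      congr 1
      simp [centralDiff]
    -- The radius `M + 1`: ρ is supported in the unit ball and, for `‖y‖ ≤ 1`, the shifts `(j - M)
    -- y` have length at most M. On that ball the weight varies by at most `(1 + (M + 1))^q`.
    refine ⟨C * (1 + (M + 1 : ℝ)) ^ q * volume.real (Metric.closedBall (0 : E) (M + 1)),
      by positivity, fun x y hy => ?_⟩
    have hD : centralDiff M y (fun x => ∫ z, polyWeight q z * ρ (x - z)) x =
        ∫ z, polyWeight q z * centralDiff M y ρ (x - z) := by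
      unfold centralDiff
      simp_rw [smul_eq_mul, ← integral_const_mul]
      rw [← integral_finsetSum]
      · refine integral_congr_ae (Filter.Eventually.of_forall fun z => ?_)
        simp only [Finset.mul_sum]
        refine Finset.sum_congr rfl fun j _ => ?_
        rw [show x + ((j : ℝ) - M) • y - z = x - z + ((j : ℝ) - M) • y by abel]
        ring
      · exact fun j _ => (hwρ _).const_mul _
    rw [hD, ← Real.norm_eq_abs]
    have hbound : ∀ z, ‖polyWeight q z * centralDiff M y ρ (x - z)‖ ≤
        (Metric.closedBall x (M + 1 : ℝ)).indicator
          (fun _ => C * ‖y‖ ^ (2 * M) * ((1 + (M + 1 : ℝ)) ^ q * polyWeight q x)) z := by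
      intro z
      rw [norm_mul, Real.norm_eq_abs, Real.norm_eq_abs, abs_of_pos (polyWeight_pos q z)]
      by_cases hz : z ∈ Metric.closedBall x (M + 1 : ℝ)
      · rw [Set.indicator_of_mem hz, mul_comm]
        have hz' : ‖x - z‖ ≤ (M + 1 : ℝ) := by
          rw [← dist_eq_norm, dist_comm]; exact hz
        exact mul_le_mul (hC' _ _) (polyWeight_le_of_norm_sub_le hq hz') (polyWeight_pos q z).le
          (by positivity)
      · rw [Set.indicator_of_notMem hz]
        have hz' : (M + 1 : ℝ) < ‖x - z‖ := by
          rw [← dist_eq_norm, dist_comm]; simpa using hz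
        have : centralDiff M y ρ (x - z) = 0 := by
          refine Finset.sum_eq_zero fun j hj => ?_
          rw [hρs, smul_zero]
          have hj' : |(j : ℝ) - M| ≤ M := by
            have : (j : ℝ) ≤ 2 * M := by
              exact_mod_cast Nat.lt_succ_iff.mp (Finset.mem_range.mp hj)
            rw [abs_le]
            constructor <;> linarith [Nat.cast_nonneg (α := ℝ) j]
          have h1 : ‖((j : ℝ) - M) • y‖ ≤ M := by
            rw [norm_smul, Real.norm_eq_abs]
            nlinarith [norm_nonneg y, abs_nonneg ((j : ℝ) - M)]
          have h2 := norm_sub_le (x - z + ((j : ℝ) - M) • y) (((j : ℝ) - M) • y)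
          rw [add_sub_cancel_right] at h2
          linarith
        simp [this]
    refine (norm_integral_le_of_norm_le ?_ (Filter.Eventually.of_forall hbound)).trans ?_
    · rw [integrable_indicator_iff measurableSet_closedBall]
      exact integrableOn_const (measure_closedBall_lt_top).ne
    · rw [integral_indicator measurableSet_closedBall, setIntegral_const,
        Measure.addHaar_real_closedBall_center, smul_eq_mul]
      exact le_of_eq (by ring)

lemma IsSmoothWeight.pos {q : ℝ} {ψ : E → ℝ} (h : IsSmoothWeight q ψ) (x : E) : 0 < ψ x :=
  pos_of_mul_pos_right ((polyWeight_pos q x).trans_le (h.le_mul x)) (by positivity)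

lemma IsSmoothWeight.le_two_rpow {q : ℝ} (hq : 0 ≤ q) {ψ : E → ℝ} (h : IsSmoothWeight q ψ)
    (x : E) : ψ x ≤ 2 ^ q :=
  (h.le x).trans <| mul_le_of_le_one_right (by positivity) (polyWeight_le_one hq x)

lemma IsSmoothWeight.integrable {q : ℝ} (hq : (Module.finrank ℝ E : ℝ) < q) {ψ : E → ℝ}
    (h : IsSmoothWeight q ψ) : Integrable ψ := by
  refine ((integrable_one_add_norm hq).const_mul (2 ^ q)).mono'
    h.contDiff.continuous.aestronglyMeasurable (Filter.Eventually.of_forall fun x => ?_)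
  rw [Real.norm_eq_abs, abs_of_pos (h.pos x)]
  exact h.le x

/-- The kernel `‖y‖ ^ (-(d + 2γ))` of the fractional Laplacian of order `γ` in dimension `d`. -/
noncomputable def rieszKernel (γ : ℝ) (y : E) : ℝ := ‖y‖ ^ (-((Module.finrank ℝ E : ℝ) + 2 * γ))

lemma rieszKernel_nonneg (γ : ℝ) (y : E) : 0 ≤ rieszKernel γ y := Real.rpow_nonneg (norm_nonneg _) _

lemma measurable_rieszKernel (γ : ℝ) : Measurable (rieszKernel γ : E → ℝ) := by
  unfold rieszKernel
  fun_prop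

lemma rieszKernel_smul {r : ℝ} (hr : 0 < r) (γ : ℝ) (y : E) :
    rieszKernel γ (r • y) = r ^ (-((Module.finrank ℝ E : ℝ) + 2 * γ)) * rieszKernel γ y := by
  unfold rieszKernel
  rw [norm_smul, Real.norm_eq_abs, abs_of_pos hr, Real.mul_rpow hr.le (norm_nonneg _)]

lemma rieszKernel_le_polyWeight {γ q : ℝ} (hq : q ≤ Module.finrank ℝ E + 2 * γ)
    (hq0 : 0 ≤ q) {y : E} (hy : 1 ≤ ‖y‖) : rieszKernel γ y ≤ 2 ^ q * polyWeight q y := by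
  unfold rieszKernel polyWeight
  calc _ ≤ ‖y‖ ^ (-q) := Real.rpow_le_rpow_of_exponent_le hy (by linarith)
    _ ≤ ((1 + ‖y‖) / 2) ^ (-q) :=
        Real.rpow_le_rpow_of_nonpos (by positivity) (by linarith) (by linarith)
    _ = _ := by
        rw [Real.div_rpow (by positivity) (by norm_num), Real.rpow_neg (by norm_num : (0 : ℝ) ≤ 2),
          div_inv_eq_mul, mul_comm]

/-- In polar coordinates the radial integrand is `r^(2M - 2γ - 1)`, with exponent above -1 because γ
< M. -/
lemma integrableOn_rieszKernel_mul_pow [Nontrivial E] {γ : ℝ} {M : ℕ} (hM : γ < M) :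
    IntegrableOn (fun y : E => rieszKernel γ y * ‖y‖ ^ (2 * M)) (Metric.ball 0 1) := by
  unfold rieszKernel
  have h1 := (integrableOn_fun_norm_addHaar (E := E) volume (r := 1)
    (f := fun r : ℝ => r ^ (-((Module.finrank ℝ E : ℝ) + 2 * γ)) * r ^ (2 * M))).2 ?_
  · exact h1
  · have h2 : IntegrableOn (fun r : ℝ => r ^ (2 * (M : ℝ) - 2 * γ - 1)) (Set.Ioo 0 1) :=
      (intervalIntegral.integrableOn_Ioo_rpow_iff one_pos).2 (by linarith)
    refine h2.congr_fun (fun r hr => ?_) measurableSet_Ioo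
    have hd : 1 ≤ Module.finrank ℝ E := Module.finrank_pos
    simp only [smul_eq_mul]
    rw [← Real.rpow_natCast r (2 * M), ← Real.rpow_natCast r (_ - 1), ← Real.rpow_add hr.1,
      ← Real.rpow_add hr.1]
    congr 1
    push_cast [hd]
    ring

lemma lintegral_polyWeight_lt_top {q : ℝ} (hq : (Module.finrank ℝ E : ℝ) < q) :
    ∫⁻ y : E, ENNReal.ofReal (polyWeight q y) < ⊤ :=
  (integrable_one_add_norm hq).lintegral_lt_top

/-- The dilation `y ↦ k y` costs `|k|^(-d)`, which is at most 1 when `|k| ≥ 1`; for `k = 0` the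
second weight is constant in y. The shifts of a central difference are integers, so these two cases
suffice. -/
lemma lintegral_polyWeight_mul_le {q m : ℝ} (hq : 0 ≤ q) {k : ℝ} (hk : |k| ≤ m)
    (hk' : k = 0 ∨ 1 ≤ |k|) (x : E) :
    ∫⁻ y, ENNReal.ofReal (polyWeight q y * polyWeight q (x + k • y)) ≤
      ENNReal.ofReal ((2 * (1 + m)) ^ q * polyWeight q x) *
        (2 * ∫⁻ y : E, ENNReal.ofReal (polyWeight q y)) := by
  have hm : 0 ≤ m := (abs_nonneg k).trans hk
  have hmeas : Measurable fun y : E => ENNReal.ofReal (polyWeight q y) :=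
    (continuous_polyWeight q).measurable.ennreal_ofReal
  rcases hk' with rfl | hk1
  · simp only [zero_smul, add_zero]
    calc _ = ∫⁻ y : E, ENNReal.ofReal (polyWeight q x) * ENNReal.ofReal (polyWeight q y) := by
          refine lintegral_congr fun y => ?_
          rw [mul_comm, ENNReal.ofReal_mul (polyWeight_pos q x).le]
      _ = ENNReal.ofReal (polyWeight q x) * ∫⁻ y : E, ENNReal.ofReal (polyWeight q y) :=
          lintegral_const_mul _ hmeas
      _ ≤ _ := by
          refine mul_le_mul' (ENNReal.ofReal_le_ofReal ?_) (le_mul_of_one_le_left' one_le_two)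
          exact le_mul_of_one_le_left (polyWeight_pos q x).le
            (Real.one_le_rpow (by linarith) hq)
  · calc _ ≤ ∫⁻ y : E, ENNReal.ofReal ((2 * (1 + m)) ^ q * polyWeight q x) *
            (ENNReal.ofReal (polyWeight q y) + ENNReal.ofReal (polyWeight q (x + k • y))) := by
          refine lintegral_mono fun y => ?_
          rw [← ENNReal.ofReal_add (polyWeight_pos q _).le (polyWeight_pos q _).le,
            ← ENNReal.ofReal_mul (mul_nonneg (by positivity) (polyWeight_pos q x).le)]
          exact ENNReal.ofReal_le_ofReal (polyWeight_mul_le hq hk x y)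
      _ = ENNReal.ofReal ((2 * (1 + m)) ^ q * polyWeight q x) *
            ((∫⁻ y : E, ENNReal.ofReal (polyWeight q y)) +
              ∫⁻ y : E, ENNReal.ofReal (polyWeight q (x + k • y))) := by
          rw [lintegral_const_mul _ (by
            refine hmeas.add ?_
            exact hmeas.comp ((measurable_const_smul k).const_add x)), lintegral_add_left hmeas]
      _ ≤ _ := by
          refine mul_le_mul_right ?_ _
          rw [two_mul]
          refine add_le_add_right ?_ _
          have hk0 : k ≠ 0 := by
            rintro rfl
            simp at hk1
            linarith
          rw [lintegral_comp_const_smul (f := fun y => ENNReal.ofReal (polyWeight q (x + y)))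
            (hmeas.comp (measurable_const_add x)) hk0,
            lintegral_add_left_eq_self (fun y => ENNReal.ofReal (polyWeight q y)) x]
          refine mul_le_of_le_one_left' ?_
          rw [ENNReal.ofReal_le_one, abs_inv, abs_pow]
          exact inv_le_one_of_one_le₀ (one_le_pow₀ hk1)

end SmoothWeight

/-! ### Differences of a weight integrated against the Riesz kernel -/

section KernelBound

variable {E : Type*} [NormedAddCommGroup E] [InnerProductSpace ℝ E] [FiniteDimensional ℝ E]
  [MeasurableSpace E] [BorelSpace E]

lemma continuous_centralDiff {F : Type*} [NormedAddCommGroup F] [NormedSpace ℝ F] {f : E → F}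
    (hf : Continuous f) (M : ℕ) : Continuous fun z : E × E => centralDiff M z.1 f z.2 := by
  unfold centralDiff
  fun_prop

lemma abs_natCast_sub_le {M j : ℕ} (hj : j ∈ Finset.range (2 * M + 1)) : |(j : ℝ) - M| ≤ M := by
  have : (j : ℝ) ≤ 2 * M := by exact_mod_cast Nat.lt_succ_iff.mp (Finset.mem_range.mp hj)
  rw [abs_le]
  constructor <;> linarith [Nat.cast_nonneg (α := ℝ) j]

lemma natCast_sub_eq_zero_or_one_le_abs (M j : ℕ) : (j : ℝ) - M = 0 ∨ 1 ≤ |(j : ℝ) - M| := by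
  rcases eq_or_ne ((j : ℤ) - M) 0 with h | h
  · left
    exact_mod_cast h
  · right
    exact_mod_cast Int.one_le_abs h

/-- For `‖y‖ < 1` the factor `‖y‖^(2M)` of the difference beats the singularity of the kernel. For
`‖y‖ ≥ 1` cancellation is not needed: the kernel is dominated by the weight in y because `q ≤ d +
2γ`, and each product of weights is integrable in y with a bound proportional to the weight at x
because `q > d`. -/
theorem IsSmoothWeight.lintegral_rieszKernel_mul_centralDiff_le [Nontrivial E] {γ q : ℝ} {M : ℕ}
    {ψ : E → ℝ} (h : IsSmoothWeight q ψ) (hM : γ < M) (hd : (Module.finrank ℝ E : ℝ) < q)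
    (hq : q ≤ Module.finrank ℝ E + 2 * γ) :
    ∃ C : ENNReal, C ≠ ⊤ ∧ ∀ x, ∫⁻ y, ENNReal.ofReal (rieszKernel γ y * |centralDiff M y ψ x|) ≤
      C * ENNReal.ofReal (ψ x) := by
  have hq0 : 0 ≤ q := (Nat.cast_nonneg _).trans hd.le
  obtain ⟨C₁, hC₁0, hC₁⟩ := h.centralDiff_le M
  set A : ENNReal := ∫⁻ y in Metric.ball (0 : E) 1, ENNReal.ofReal (rieszKernel γ y * ‖y‖ ^ (2 * M))
  have hA : A < ⊤ := (integrableOn_rieszKernel_mul_pow (E := E) hM).lintegral_lt_top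
  set W : ENNReal := ∫⁻ y : E, ENNReal.ofReal (polyWeight q y)
  have hW : W < ⊤ := lintegral_polyWeight_lt_top hd
  set B : ENNReal := ∑ j ∈ Finset.range (2 * M + 1),
    ENNReal.ofReal (|centralDiffCoeff M j| * (2 ^ q * 2 ^ q)) *
      (ENNReal.ofReal ((2 * (1 + (M : ℝ))) ^ q) * (2 * W)) with hB
  have hBt : B < ⊤ := ENNReal.sum_lt_top.2 fun j _ => by finiteness
  refine ⟨(ENNReal.ofReal C₁ * A + B) * ENNReal.ofReal (2 ^ q), by finiteness, fun x => ?_⟩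
  have hnear : ∫⁻ y in Metric.ball (0 : E) 1,
      ENNReal.ofReal (rieszKernel γ y * |centralDiff M y ψ x|) ≤
      ENNReal.ofReal C₁ * A * ENNReal.ofReal (polyWeight q x) := by
    calc _ ≤ ∫⁻ y in Metric.ball (0 : E) 1, ENNReal.ofReal (C₁ * polyWeight q x) *
          ENNReal.ofReal (rieszKernel γ y * ‖y‖ ^ (2 * M)) := by
          refine setLIntegral_mono' Metric.isOpen_ball.measurableSet fun y hy => ?_
          rw [← ENNReal.ofReal_mul (mul_nonneg hC₁0 (polyWeight_pos q x).le)]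
          refine ENNReal.ofReal_le_ofReal ?_
          calc _ ≤ rieszKernel γ y * (C₁ * ‖y‖ ^ (2 * M) * polyWeight q x) :=
                mul_le_mul_of_nonneg_left (hC₁ x y (by simpa using (Metric.mem_ball.mp hy).le))
                  (rieszKernel_nonneg γ y)
            _ = _ := by ring
      _ = _ := by
          rw [lintegral_const_mul' _ _ ENNReal.ofReal_ne_top, ENNReal.ofReal_mul hC₁0]
          ring
  have hfar : ∫⁻ y in (Metric.ball (0 : E) 1)ᶜ,
      ENNReal.ofReal (rieszKernel γ y * |centralDiff M y ψ x|) ≤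
      B * ENNReal.ofReal (polyWeight q x) := by
    have hw : Continuous (polyWeight q : E → ℝ) := continuous_polyWeight q
    calc _ ≤ ∫⁻ y in (Metric.ball (0 : E) 1)ᶜ, ∑ j ∈ Finset.range (2 * M + 1),
          ENNReal.ofReal (|centralDiffCoeff M j| * (2 ^ q * 2 ^ q)) *
            ENNReal.ofReal (polyWeight q y * polyWeight q (x + ((j : ℝ) - M) • y)) := by
          refine setLIntegral_mono' Metric.isOpen_ball.measurableSet.compl fun y hy => ?_
          have hy' : 1 ≤ ‖y‖ := by simpa using hy
          have hnn : ∀ j : ℕ, 0 ≤ |centralDiffCoeff M j| * (2 ^ q * 2 ^ q) *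
              (polyWeight q y * polyWeight q (x + ((j : ℝ) - M) • y)) := fun j =>
            mul_nonneg (by positivity) (mul_nonneg (polyWeight_pos q _).le (polyWeight_pos q _).le)
          simp_rw [← ENNReal.ofReal_mul
            (show 0 ≤ |centralDiffCoeff M _| * ((2 : ℝ) ^ q * 2 ^ q) by positivity)]
          rw [← ENNReal.ofReal_sum_of_nonneg fun j _ => hnn j]
          refine ENNReal.ofReal_le_ofReal ?_
          calc _ ≤ rieszKernel γ y * ∑ j ∈ Finset.range (2 * M + 1),
                |centralDiffCoeff M j| * ψ (x + ((j : ℝ) - M) • y) := by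
                refine mul_le_mul_of_nonneg_left ?_ (rieszKernel_nonneg γ y)
                refine (Finset.abs_sum_le_sum_abs _ _).trans (le_of_eq ?_)
                refine Finset.sum_congr rfl fun j _ => ?_
                rw [smul_eq_mul, abs_mul, abs_of_pos (h.pos _)]
            _ ≤ _ := by
                rw [Finset.mul_sum]
                refine Finset.sum_le_sum fun j _ => ?_
                have h1 := rieszKernel_le_polyWeight hq hq0 hy'
                have h2 := h.le (x + ((j : ℝ) - M) • y)
                calc _ = |centralDiffCoeff M j| *
                      (rieszKernel γ y * ψ (x + ((j : ℝ) - M) • y)) := by ring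
                  _ ≤ |centralDiffCoeff M j| * ((2 ^ q * polyWeight q y) *
                      (2 ^ q * polyWeight q (x + ((j : ℝ) - M) • y))) :=
                    mul_le_mul_of_nonneg_left (mul_le_mul h1 h2 (h.pos _).le
                      (mul_nonneg (by positivity) (polyWeight_pos q y).le)) (abs_nonneg _)
                  _ = _ := by ring
      _ ≤ ∫⁻ y, ∑ j ∈ Finset.range (2 * M + 1),
          ENNReal.ofReal (|centralDiffCoeff M j| * (2 ^ q * 2 ^ q)) *
            ENNReal.ofReal (polyWeight q y * polyWeight q (x + ((j : ℝ) - M) • y)) :=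
          setLIntegral_le_lintegral _ _
      _ = ∑ j ∈ Finset.range (2 * M + 1), ∫⁻ y,
          ENNReal.ofReal (|centralDiffCoeff M j| * (2 ^ q * 2 ^ q)) *
            ENNReal.ofReal (polyWeight q y * polyWeight q (x + ((j : ℝ) - M) • y)) := by
          refine lintegral_finsetSum _ fun j _ => ?_
          exact Measurable.const_mul (by fun_prop) _
      _ ≤ _ := by
          rw [hB, Finset.sum_mul]
          refine Finset.sum_le_sum fun j hj => ?_
          rw [lintegral_const_mul _ (by fun_prop), mul_assoc]
          refine mul_le_mul_right ((lintegral_polyWeight_mul_le hq0 (abs_natCast_sub_le hj)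
            (natCast_sub_eq_zero_or_one_le_abs M j) x).trans (le_of_eq ?_)) _
          rw [ENNReal.ofReal_mul (by positivity)]
          ring
  rw [← lintegral_add_compl _ (Metric.isOpen_ball (x := (0 : E)) (ε := 1)).measurableSet]
  calc _ ≤ ENNReal.ofReal C₁ * A * ENNReal.ofReal (polyWeight q x) +
        B * ENNReal.ofReal (polyWeight q x) := add_le_add hnear hfar
    _ = (ENNReal.ofReal C₁ * A + B) * ENNReal.ofReal (polyWeight q x) := by ring
    _ ≤ (ENNReal.ofReal C₁ * A + B) * ENNReal.ofReal (2 ^ q * ψ x) :=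
        mul_le_mul_right (ENNReal.ofReal_le_ofReal (h.le_mul x)) _
    _ = _ := by rw [ENNReal.ofReal_mul (by positivity)]; ring

lemma centralDiff_comp_smul {F : Type*} [AddCommGroup F] [Module ℝ F] (M : ℕ) (r : ℝ) (y : E)
    (f : E → F) (x : E) :
    centralDiff M y (fun z => f (r • z)) x = centralDiff M (r • y) f (r • x) := by
  unfold centralDiff
  refine Finset.sum_congr rfl fun j _ => ?_
  simp only [smul_add, smul_comm r]

/-- Substituting `y ↦ y/R`, the homogeneity of the kernel gives `R^(-(d + 2γ))` and the Jacobian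
gives `R^d`. -/
lemma lintegral_rieszKernel_mul_centralDiff_comp_smul {γ : ℝ} {M : ℕ} {ψ : E → ℝ}
    (hψ : Continuous ψ) {R : ℝ} (hR : 0 < R) (x : E) :
    ∫⁻ y, ENNReal.ofReal (rieszKernel γ y * |centralDiff M y (fun z => ψ (R⁻¹ • z)) x|) =
      ENNReal.ofReal (R ^ (-(2 * γ))) *
        ∫⁻ y, ENNReal.ofReal (rieszKernel γ y * |centralDiff M y ψ (R⁻¹ • x)|) := by
  have hmeas : Measurable fun y : E =>
      ENNReal.ofReal (rieszKernel γ y * |centralDiff M y ψ (R⁻¹ • x)|) := by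
    refine ((measurable_rieszKernel γ).mul (Continuous.measurable ?_)).ennreal_ofReal
    exact ((continuous_centralDiff hψ M).comp (continuous_id.prodMk continuous_const)).abs
  have h1 : ∀ y : E,
      ENNReal.ofReal (rieszKernel γ y * |centralDiff M y (fun z => ψ (R⁻¹ • z)) x|) =
      ENNReal.ofReal (R ^ (-((Module.finrank ℝ E : ℝ) + 2 * γ))) *
        ENNReal.ofReal (rieszKernel γ (R⁻¹ • y) * |centralDiff M (R⁻¹ • y) ψ (R⁻¹ • x)|) := by
    intro y
    rw [centralDiff_comp_smul, ← ENNReal.ofReal_mul (by positivity), ← mul_assoc,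
      ← rieszKernel_smul hR, smul_inv_smul₀ hR.ne']
  simp_rw [h1]
  rw [lintegral_const_mul' _ _ ENNReal.ofReal_ne_top,
    lintegral_comp_const_smul hmeas (inv_ne_zero hR.ne'), ← mul_assoc,
    ← ENNReal.ofReal_mul (by positivity)]
  congr 2
  rw [inv_pow, inv_inv, abs_of_pos (by positivity), ← Real.rpow_natCast, ← Real.rpow_add hR]
  congr 1
  ring

end KernelBound

/-! ### The multiplier as an integral of difference symbols -/

section SymbolIntegral

variable {E : Type*} [NormedAddCommGroup E] [InnerProductSpace ℝ E] [FiniteDimensional ℝ E]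
  [MeasurableSpace E] [BorelSpace E]

/-- The Fourier symbol of the central difference of order `2 * M` with step `y`. -/
noncomputable def centralDiffSymbol (M : ℕ) (y ξ : E) : ℝ :=
  (2 - 2 * Real.cos (2 * Real.pi * inner ℝ y ξ)) ^ M

lemma centralDiffSymbol_nonneg (M : ℕ) (y ξ : E) : 0 ≤ centralDiffSymbol M y ξ :=
  pow_nonneg (two_sub_two_mul_cos_nonneg _) _

lemma continuous_centralDiffSymbol (M : ℕ) :
    Continuous fun z : E × E => centralDiffSymbol M z.1 z.2 := by
  unfold centralDiffSymbol
  fun_prop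

lemma centralDiffSymbol_le_four_pow (M : ℕ) (y ξ : E) : centralDiffSymbol M y ξ ≤ 4 ^ M :=
  pow_le_pow_left₀ (two_sub_two_mul_cos_nonneg _) (two_sub_two_mul_cos_le_four _) _

lemma centralDiffSymbol_le (M : ℕ) (y ξ : E) :
    centralDiffSymbol M y ξ ≤ (2 * Real.pi * ‖ξ‖) ^ (2 * M) * ‖y‖ ^ (2 * M) := by
  rw [← mul_pow, pow_mul]
  refine pow_le_pow_left₀ (two_sub_two_mul_cos_nonneg _)
    ((two_sub_two_mul_cos_le_sq _).trans ?_) _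
  rw [← sq_abs]
  refine pow_le_pow_left₀ (abs_nonneg _) ?_ _
  rw [abs_mul, abs_of_pos Real.two_pi_pos, mul_assoc (2 * Real.pi) ‖ξ‖, mul_comm ‖ξ‖]
  exact mul_le_mul_of_nonneg_left (abs_real_inner_le_norm y ξ) Real.two_pi_pos.le

/-- The integral of the symbol of the central difference against the Riesz kernel. -/
noncomputable def symbolIntegral (γ : ℝ) (M : ℕ) (ξ : E) : ENNReal :=
  ∫⁻ y, ENNReal.ofReal (rieszKernel γ y * centralDiffSymbol M y ξ)

lemma measurable_rieszKernel_mul_centralDiffSymbol (γ : ℝ) (M : ℕ) :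
    Measurable fun z : E × E => rieszKernel γ z.1 * centralDiffSymbol M z.1 z.2 :=
  ((measurable_rieszKernel γ).comp measurable_fst).mul (continuous_centralDiffSymbol M).measurable

lemma measurable_rieszKernel_mul_centralDiffSymbol_left (γ : ℝ) (M : ℕ) (ξ : E) :
    Measurable fun y : E => rieszKernel γ y * centralDiffSymbol M y ξ :=
  (measurable_rieszKernel_mul_centralDiffSymbol γ M).comp (measurable_id.prodMk measurable_const)

/-- The symbol is `O(‖y‖^(2M))` near the origin, with M > γ, and at most `4^M` at infinity, where
the kernel is integrable because γ > 0. -/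
lemma symbolIntegral_lt_top [Nontrivial E] {γ : ℝ} (hγ : 0 < γ) {M : ℕ} (hM : γ < M) (ξ : E) :
    symbolIntegral γ M ξ < ⊤ := by
  unfold symbolIntegral
  rw [← lintegral_add_compl _ (Metric.isOpen_ball (x := (0 : E)) (ε := 1)).measurableSet]
  refine ENNReal.add_lt_top.2 ⟨?_, ?_⟩
  · calc _ ≤ ∫⁻ y in Metric.ball (0 : E) 1, ENNReal.ofReal ((2 * Real.pi * ‖ξ‖) ^ (2 * M)) *
          ENNReal.ofReal (rieszKernel γ y * ‖y‖ ^ (2 * M)) := by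
          refine lintegral_mono fun y => ?_
          rw [← ENNReal.ofReal_mul (by positivity)]
          refine ENNReal.ofReal_le_ofReal ((mul_le_mul_of_nonneg_left (centralDiffSymbol_le M y ξ)
            (rieszKernel_nonneg γ y)).trans (le_of_eq (by ring)))
      _ < ⊤ := by
          rw [lintegral_const_mul' _ _ ENNReal.ofReal_ne_top]
          exact ENNReal.mul_lt_top ENNReal.ofReal_lt_top
            (integrableOn_rieszKernel_mul_pow (E := E) hM).lintegral_lt_top
  · have hq : (Module.finrank ℝ E : ℝ) < Module.finrank ℝ E + 2 * γ := by linarith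
    have hq0 : (0 : ℝ) ≤ Module.finrank ℝ E + 2 * γ := by positivity
    calc _ ≤ ∫⁻ y in (Metric.ball (0 : E) 1)ᶜ,
          ENNReal.ofReal (2 ^ ((Module.finrank ℝ E : ℝ) + 2 * γ) * 4 ^ M) *
          ENNReal.ofReal (polyWeight (Module.finrank ℝ E + 2 * γ) y) := by
          refine setLIntegral_mono' Metric.isOpen_ball.measurableSet.compl fun y hy => ?_
          have hy' : 1 ≤ ‖y‖ := by simpa using hy
          rw [← ENNReal.ofReal_mul (by positivity)]
          refine ENNReal.ofReal_le_ofReal ((mul_le_mul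
            (rieszKernel_le_polyWeight le_rfl hq0 hy')
            (centralDiffSymbol_le_four_pow M y ξ) (centralDiffSymbol_nonneg M y ξ)
            (mul_nonneg (by positivity) (polyWeight_pos _ _).le)).trans (le_of_eq (by ring)))
      _ ≤ ∫⁻ y, ENNReal.ofReal (2 ^ ((Module.finrank ℝ E : ℝ) + 2 * γ) * 4 ^ M) *
          ENNReal.ofReal (polyWeight (Module.finrank ℝ E + 2 * γ) y) :=
          setLIntegral_le_lintegral _ _
      _ < ⊤ := by
          rw [lintegral_const_mul' _ _ ENNReal.ofReal_ne_top]
          exact ENNReal.mul_lt_top ENNReal.ofReal_lt_top (lintegral_polyWeight_lt_top hq)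

lemma symbolIntegral_pos {γ : ℝ} (M : ℕ) {ξ : E} (hξ : ξ ≠ 0) : 0 < symbolIntegral γ M ξ := by
  unfold symbolIntegral
  rw [lintegral_pos_iff_support
    (measurable_rieszKernel_mul_centralDiffSymbol_left γ M ξ).ennreal_ofReal]
  -- On this open slab `⟨y, ξ⟩` lies strictly between two consecutive integers, so the cosine is not
  -- 1 and the integrand is positive.
  set U : Set E := {y | 0 < inner ℝ y ξ} ∩ {y | inner ℝ y ξ < 1} with hU
  have hUo : IsOpen U := by
    refine IsOpen.inter ?_ ?_
    · exact isOpen_lt continuous_const (by fun_prop)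
    · exact isOpen_lt (by fun_prop) continuous_const
  have hξ' : 0 < ‖ξ‖ ^ 2 := by positivity
  have hUn : U.Nonempty := by
    refine ⟨(1 / (2 * ‖ξ‖ ^ 2)) • ξ, ?_, ?_⟩
    · simp only [Set.mem_ofPred_eq, real_inner_smul_left, real_inner_self_eq_norm_sq]
      positivity
    · simp only [Set.mem_ofPred_eq, real_inner_smul_left, real_inner_self_eq_norm_sq]
      field_simp
      norm_num
  refine (hUo.measure_pos volume hUn).trans_le (measure_mono fun y hy => ?_)
  rw [Function.mem_support, ne_eq, ENNReal.ofReal_eq_zero, not_le]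
  have hy0 : y ≠ 0 := by
    rintro rfl
    simpa using hy.1
  have h1 : 0 < rieszKernel γ y := Real.rpow_pos_of_pos (norm_pos_iff.2 hy0) _
  refine mul_pos h1 (pow_pos ?_ _)
  have h2 : Real.cos (2 * Real.pi * inner ℝ y ξ) ≠ 1 := by
    intro h
    obtain ⟨k, hk⟩ := (Real.cos_eq_one_iff _).1 h
    have hk' : (k : ℝ) = inner ℝ y ξ := by
      have := Real.two_pi_pos
      have h3 : (2 * Real.pi) * k = (2 * Real.pi) * inner ℝ y ξ := by rw [← hk]; ring
      exact mul_left_cancel₀ this.ne' h3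
    have h4 := hy.1
    have h5 := hy.2
    simp only [Set.mem_ofPred_eq, ← hk'] at h4 h5
    have h6 : 0 < k := by exact_mod_cast h4
    have h7 : k < 1 := by exact_mod_cast h5
    omega
  have := lt_of_le_of_ne (Real.cos_le_one _) h2
  linarith

/-- The reflection across the hyperplane orthogonal to `ξ - η` sends ξ to η and preserves both the
measure and the kernel. With homogeneity this determines the integral up to a constant. -/
lemma symbolIntegral_congr_norm (γ : ℝ) (M : ℕ) {ξ η : E} (h : ‖ξ‖ = ‖η‖) :
    symbolIntegral γ M ξ = symbolIntegral γ M η := by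
  set T := (Submodule.span ℝ {ξ - η})ᗮ.reflection with hT
  have hTξ : T ξ = η := Submodule.reflection_sub h
  have h1 := (T.measurePreserving).lintegral_comp_emb (T.toHomeomorph.measurableEmbedding)
    fun y => ENNReal.ofReal (rieszKernel γ y * centralDiffSymbol M y η)
  unfold symbolIntegral
  rw [← h1]
  refine lintegral_congr fun y => ?_
  congr 2
  · simp [rieszKernel]
  · rw [centralDiffSymbol, centralDiffSymbol, ← hTξ, LinearIsometryEquiv.inner_map_map]

lemma symbolIntegral_smul (γ : ℝ) (M : ℕ) {r : ℝ} (hr : 0 < r) (ξ : E) :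
    symbolIntegral γ M (r • ξ) = ENNReal.ofReal (r ^ (2 * γ)) * symbolIntegral γ M ξ := by
  have hmeas : Measurable fun y : E =>
      ENNReal.ofReal (rieszKernel γ y * centralDiffSymbol M y ξ) :=
    (measurable_rieszKernel_mul_centralDiffSymbol_left γ M ξ).ennreal_ofReal
  have h1 : ∀ y : E, ENNReal.ofReal (rieszKernel γ y * centralDiffSymbol M y (r • ξ)) =
      ENNReal.ofReal (r ^ ((Module.finrank ℝ E : ℝ) + 2 * γ)) *
        ENNReal.ofReal (rieszKernel γ (r • y) * centralDiffSymbol M (r • y) ξ) := by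
    intro y
    rw [← ENNReal.ofReal_mul (by positivity), ← mul_assoc, rieszKernel_smul hr, ← mul_assoc,
      ← Real.rpow_add hr, add_neg_cancel, Real.rpow_zero, one_mul, centralDiffSymbol,
      centralDiffSymbol, real_inner_smul_left, real_inner_smul_right]
  unfold symbolIntegral
  simp_rw [h1]
  rw [lintegral_const_mul' _ _ ENNReal.ofReal_ne_top, lintegral_comp_const_smul hmeas hr.ne',
    ← mul_assoc, ← ENNReal.ofReal_mul (by positivity)]
  congr 2
  rw [abs_of_pos (by positivity), ← Real.rpow_natCast, ← Real.rpow_neg hr.le, ← Real.rpow_add hr]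
  congr 1
  ring

/-- The multiplier `(2π‖ξ‖) ^ (2γ)` is a superposition of symbols of central differences. -/
theorem exists_symbolIntegral_eq [Nontrivial E] {γ : ℝ} (hγ : 0 < γ) {M : ℕ} (hM : γ < M) :
    ∃ c : ℝ, 0 < c ∧ ∀ ξ : E,
      symbolIntegral γ M ξ = ENNReal.ofReal (c * (2 * Real.pi * ‖ξ‖) ^ (2 * γ)) := by
  obtain ⟨e, he⟩ := exists_norm_eq E zero_le_one
  have he0 : e ≠ 0 := by
    rintro rfl
    simp at he
  set J := symbolIntegral γ M e with hJ
  have hJt : J ≠ ⊤ := (symbolIntegral_lt_top hγ hM e).ne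
  have hJ0 : 0 < J.toReal := ENNReal.toReal_pos (symbolIntegral_pos M he0).ne' hJt
  refine ⟨J.toReal * (2 * Real.pi) ^ (-(2 * γ)), by positivity, fun ξ => ?_⟩
  have h2 : J.toReal * (2 * Real.pi) ^ (-(2 * γ)) * (2 * Real.pi * ‖ξ‖) ^ (2 * γ) =
      ‖ξ‖ ^ (2 * γ) * J.toReal := by
    rw [Real.mul_rpow (by positivity) (norm_nonneg _), Real.rpow_neg (by positivity)]
    field_simp
  rw [h2, ENNReal.ofReal_mul (by positivity), ENNReal.ofReal_toReal hJt]
  rcases eq_or_ne ξ 0 with rfl | hξ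
  · have hM0 : M ≠ 0 := by
      rintro rfl
      simp at hM
      linarith
    rw [norm_zero, Real.zero_rpow (by positivity), ENNReal.ofReal_zero, zero_mul]
    simp [symbolIntegral, centralDiffSymbol, hM0]
  · rw [hJ, ← symbolIntegral_smul γ M (norm_pos_iff.2 hξ)]
    exact symbolIntegral_congr_norm γ M (by simp [norm_smul, he])

end SymbolIntegral

/-! ### Translations and central differences on the Fourier side in L² -/

section FourierTranslation

variable {E : Type*} [NormedAddCommGroup E] [InnerProductSpace ℝ E] [FiniteDimensional ℝ E]
  [MeasurableSpace E] [BorelSpace E]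

/-- Translation `f ↦ f (· + y)` on `L²`. -/
noncomputable def translateL2 (y : E) : Lp ℂ 2 (volume : Measure E) →ₗᵢ[ℂ] Lp ℂ 2 (volume : Measure E) :=
  Lp.compMeasurePreservingₗᵢ ℂ (· + y) (measurePreserving_add_right volume y)

lemma coeFn_translateL2 (y : E) (f : Lp ℂ 2 (volume : Measure E)) :
    translateL2 y f =ᵐ[volume] fun x => f (x + y) :=
  Lp.coeFn_compMeasurePreserving f (measurePreserving_add_right volume y)

lemma SchwartzMap.fourier_compSubConst (f : 𝓢(E, ℂ)) (y ξ : E) :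
    𝓕 (f.compSubConstCLM ℂ (-y)) ξ =
      Complex.exp (↑(2 * Real.pi * inner ℝ y ξ) * Complex.I) * 𝓕 f ξ := by
  have h := congrFun (VectorFourier.fourierIntegral_comp_add_right Real.fourierChar volume
    (innerₗ E) (f : E → ℂ) y) ξ
  simp only [innerₗ_apply_apply, Circle.smul_def, Real.fourierChar_apply, smul_eq_mul] at h
  have h1 : (f.compSubConstCLM ℂ (-y) : E → ℂ) = f ∘ fun v => v + y := by
    ext v
    simp
  rw [SchwartzMap.fourier_coe, SchwartzMap.fourier_coe, h1]
  exact h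

/-- Both sides are continuous in f on L², the right one because multiplication by a bounded function
is a Hölder pairing of L^∞ with L². It is therefore enough to check Schwartz functions, where the
identity is the classical one. -/
lemma fourier_translateL2 (y : E) (f : Lp ℂ 2 (volume : Measure E)) :
    (𝓕 (translateL2 y f) : Lp ℂ 2 (volume : Measure E)) =ᵐ[volume]
      fun ξ => Complex.exp (↑(2 * Real.pi * inner ℝ y ξ) * Complex.I) *
        (𝓕 f : Lp ℂ 2 (volume : Measure E)) ξ := by
  have he : MemLp (fun ξ : E => Complex.exp (↑(2 * Real.pi * inner ℝ y ξ) * Complex.I)) ⊤ volume :=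
    memLp_top_of_bound (by fun_prop) 1
      (Filter.Eventually.of_forall fun ξ => by rw [Complex.norm_exp_ofReal_mul_I])
  have key : (𝓕 (translateL2 y f) : Lp ℂ 2 (volume : Measure E)) =
      (ContinuousLinearMap.mul ℂ ℂ).holderL volume ⊤ 2 2 (he.toLp _) (𝓕 f) := by
    refine DenseRange.induction_on (p := fun f : Lp ℂ 2 (volume : Measure E) =>
      (𝓕 (translateL2 y f) : Lp ℂ 2 (volume : Measure E)) =
        (ContinuousLinearMap.mul ℂ ℂ).holderL volume ⊤ 2 2 (he.toLp _) (𝓕 f))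
      (SchwartzMap.denseRange_toLpCLM (p := 2) ENNReal.ofNat_ne_top) f ?_ fun f => ?_
    · refine isClosed_eq ?_ ?_
      · exact (Lp.fourierTransformₗᵢ E ℂ).continuous.comp (translateL2 y).continuous
      · exact (ContinuousLinearMap.continuous _).comp (Lp.fourierTransformₗᵢ E ℂ).continuous
    · have h1 : translateL2 y (f.toLp 2) = (f.compSubConstCLM ℂ (-y)).toLp 2 := by
        refine Lp.ext ?_
        filter_upwards [coeFn_translateL2 y (f.toLp 2), (f.compSubConstCLM ℂ (-y)).coeFn_toLp 2,
          (measurePreserving_add_right volume y).quasiMeasurePreserving.ae_eq_comp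
            (f.coeFn_toLp 2)]
          with x h1 h2 h3
        rw [h1, h2]
        refine h3.trans ?_
        simp
      rw [SchwartzMap.toLpCLM_apply, h1, SchwartzMap.toLp_fourier_eq, SchwartzMap.toLp_fourier_eq]
      refine Lp.ext ?_
      filter_upwards [(ContinuousLinearMap.mul ℂ ℂ).coeFn_holder (r := 2) (he.toLp _)
        ((𝓕 f).toLp 2), (𝓕 (f.compSubConstCLM ℂ (-y))).coeFn_toLp 2, (𝓕 f).coeFn_toLp 2,
        he.coeFn_toLp] with ξ h1 h2 h3 h4
      rw [h2]
      refine Eq.trans ?_ h1.symm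
      rw [h3, h4, SchwartzMap.fourier_compSubConst]
      rfl
  rw [key]
  filter_upwards [(ContinuousLinearMap.mul ℂ ℂ).coeFn_holder (r := 2) (he.toLp _) (𝓕 f),
    he.coeFn_toLp] with ξ h1 h2
  refine h1.trans ?_
  rw [h2]
  rfl

/-- The central difference of order `2 * M` with step `y` on `L²`. -/
noncomputable def centralDiffL2 (M : ℕ) (y : E) (f : Lp ℂ 2 (volume : Measure E)) :
    Lp ℂ 2 (volume : Measure E) :=
  ∑ j ∈ Finset.range (2 * M + 1), (centralDiffCoeff M j : ℂ) • translateL2 (((j : ℝ) - M) • y) f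

lemma coeFn_centralDiffL2 (M : ℕ) (y : E) {g : E → ℂ} (hg : MemLp g 2 volume) :
    centralDiffL2 M y (hg.toLp g) =ᵐ[volume] centralDiff M y g := by
  have h1 : ∀ j : ℕ, ∀ᵐ x, ((centralDiffCoeff M j : ℂ) •
      translateL2 (((j : ℝ) - M) • y) (hg.toLp g) : Lp ℂ 2 volume) x =
      centralDiffCoeff M j • g (x + ((j : ℝ) - M) • y) := by
    intro j
    filter_upwards [Lp.coeFn_smul (centralDiffCoeff M j : ℂ)
      (translateL2 (((j : ℝ) - M) • y) (hg.toLp g)),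
      coeFn_translateL2 (((j : ℝ) - M) • y) (hg.toLp g),
      (measurePreserving_add_right volume (((j : ℝ) - M) • y)).quasiMeasurePreserving.ae
        hg.coeFn_toLp] with x h1 h2 h3
    rw [h1, Pi.smul_apply, h2, h3]
    simp
  filter_upwards [Lp.coeFn_finsetSum (Finset.range (2 * M + 1)) fun j =>
    (centralDiffCoeff M j : ℂ) • translateL2 (((j : ℝ) - M) • y) (hg.toLp g), ae_all_iff.2 h1]
    with x h2 h3
  refine h2.trans ?_
  simp only [Finset.sum_apply, h3, centralDiff]

lemma fourier_centralDiffL2 (M : ℕ) (y : E) (f : Lp ℂ 2 (volume : Measure E)) :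
    (𝓕 (centralDiffL2 M y f) : Lp ℂ 2 (volume : Measure E)) =ᵐ[volume]
      fun ξ => (centralDiffSymbol M y ξ : ℂ) * (𝓕 f : Lp ℂ 2 (volume : Measure E)) ξ := by
  have h0 : (𝓕 (centralDiffL2 M y f) : Lp ℂ 2 (volume : Measure E)) =
      ∑ j ∈ Finset.range (2 * M + 1),
        (centralDiffCoeff M j : ℂ) • 𝓕 (translateL2 (((j : ℝ) - M) • y) f) := by
    unfold centralDiffL2
    refine (map_sum (Lp.fourierTransformₗᵢ E ℂ) _ _).trans ?_
    refine Finset.sum_congr rfl fun j _ => ?_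
    exact (Lp.fourierTransformₗᵢ E ℂ).map_smul _ _
  have h1 : ∀ j : ℕ, ∀ᵐ ξ, ((centralDiffCoeff M j : ℂ) •
      𝓕 (translateL2 (((j : ℝ) - M) • y) f) : Lp ℂ 2 volume) ξ =
      (centralDiffCoeff M j : ℂ) *
        Complex.exp ((((j : ℝ) - M) * (2 * Real.pi * inner ℝ y ξ) : ℝ) * Complex.I) *
        (𝓕 f : Lp ℂ 2 (volume : Measure E)) ξ := by
    intro j
    filter_upwards [Lp.coeFn_smul (centralDiffCoeff M j : ℂ)
      (𝓕 (translateL2 (((j : ℝ) - M) • y) f) : Lp ℂ 2 (volume : Measure E)),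
      fourier_translateL2 (((j : ℝ) - M) • y) f] with ξ h1 h2
    rw [h1, Pi.smul_apply, h2, real_inner_smul_left, smul_eq_mul, mul_assoc]
    ring_nf
  rw [h0]
  filter_upwards [Lp.coeFn_finsetSum (Finset.range (2 * M + 1)) fun j =>
    ((centralDiffCoeff M j : ℂ) • 𝓕 (translateL2 (((j : ℝ) - M) • y) f) : Lp ℂ 2 volume),
    ae_all_iff.2 h1] with ξ h2 h3
  refine h2.trans ?_
  simp only [Finset.sum_apply, h3]
  rw [← Finset.sum_mul, sum_centralDiffCoeff_mul_exp, centralDiffSymbol]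

end FourierTranslation

/-! ### Moving the fractional Laplacian onto the test function -/

section Duality

lemma fourier_fracLaplacian {n : ℕ} {γ : ℝ} {f : L2 n} (h : MemLp (fracSymbolMul γ f) 2 volume) :
    (𝓕 (fracLaplacian γ f) : L2 n) = h.toLp (fracSymbolMul γ f) := by
  rw [fracLaplacian, dif_pos h]
  exact FourierTransform.fourier_fourierInv_eq _

lemma fracLaplacian_zero_left {n : ℕ} (f : L2 n) : fracLaplacian 0 f = f := by
  have h0 : fracSymbolMul 0 f = (𝓕 f : L2 n) := by
    ext ξ
    simp [fracSymbolMul]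
  have h : MemLp (fracSymbolMul 0 f) 2 volume := by
    rw [h0]
    exact Lp.memLp _
  rw [fracLaplacian, dif_pos h]
  have : h.toLp (fracSymbolMul 0 f) = (𝓕 f : L2 n) := by
    refine Lp.ext (h.coeFn_toLp.trans ?_)
    rw [h0]
  rw [this]
  exact FourierTransform.fourierInv_fourier_eq _

lemma fracLaplacian_zero {n : ℕ} (γ : ℝ) : fracLaplacian γ (0 : L2 n) = 0 := by
  have h0 : fracSymbolMul γ (0 : L2 n) =ᵐ[volume] 0 := by
    have h1 : (𝓕 (0 : L2 n) : L2 n) = 0 := (Lp.fourierTransformₗᵢ _ ℂ).map_zero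
    filter_upwards [Lp.coeFn_zero ℂ 2 (volume : Measure (EuclideanSpace ℝ (Fin n)))] with ξ h2
    rw [fracSymbolMul, h1, h2]
    simp
  have h : MemLp (fracSymbolMul γ (0 : L2 n)) 2 volume := (memLp_congr_ae h0).2 MemLp.zero
  rw [fracLaplacian, dif_pos h]
  have : h.toLp (fracSymbolMul γ (0 : L2 n)) = 0 :=
    Lp.ext (h.coeFn_toLp.trans (h0.trans (Lp.coeFn_zero _ _ _).symm))
  rw [this]
  exact (Lp.fourierTransformₗᵢ _ ℂ).symm.map_zero

lemma integral_rieszKernel_mul_centralDiffSymbol {E : Type*} [NormedAddCommGroup E]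
    [InnerProductSpace ℝ E] [FiniteDimensional ℝ E] [MeasurableSpace E] [BorelSpace E]
    {γ c : ℝ} (hc : 0 ≤ c) {M : ℕ} {ξ : E}
    (h : symbolIntegral γ M ξ = ENNReal.ofReal (c * (2 * Real.pi * ‖ξ‖) ^ (2 * γ))) :
    ∫ y, rieszKernel γ y * centralDiffSymbol M y ξ = c * (2 * Real.pi * ‖ξ‖) ^ (2 * γ) := by
  rw [integral_eq_lintegral_of_nonneg_ae
    (Filter.Eventually.of_forall fun y => mul_nonneg (rieszKernel_nonneg γ y)
      (centralDiffSymbol_nonneg M y ξ))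
    (measurable_rieszKernel_mul_centralDiffSymbol_left γ M ξ).aestronglyMeasurable]
  rw [← symbolIntegral, h, ENNReal.toReal_ofReal (by positivity)]

/-- The pairing of a fractional Laplacian with a test function is controlled by the finite
differences of the test function. -/
theorem enorm_inner_fracLaplacian_le {n : ℕ} [Nontrivial (EuclideanSpace ℝ (Fin n))] {γ : ℝ}
    (hγ : 0 < γ) {M : ℕ} (hM : γ < M) :
    ∃ C : ENNReal, C ≠ ⊤ ∧ ∀ u : L2 n, MemLp (fracSymbolMul γ u) 2 volume →
      ∀ g : EuclideanSpace ℝ (Fin n) → ℂ, Continuous g → ∀ hg : MemLp g 2 volume,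
      ‖(inner ℂ (hg.toLp g) (fracLaplacian γ u) : ℂ)‖ₑ ≤
        C * ∫⁻ x, ‖u x‖ₑ * ∫⁻ y, ENNReal.ofReal (rieszKernel γ y) * ‖centralDiff M y g x‖ₑ := by
  obtain ⟨c, hc, hJ⟩ := exists_symbolIntegral_eq (E := EuclideanSpace ℝ (Fin n)) hγ hM
  refine ⟨ENNReal.ofReal c⁻¹, ENNReal.ofReal_ne_top, fun u hu g hgc hg => ?_⟩
  set G : L2 n := hg.toLp g with hG
  set H : EuclideanSpace ℝ (Fin n) → ℂ := fun ξ => inner ℂ ((𝓕 G : L2 n) ξ) ((𝓕 u : L2 n) ξ) with hH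
  have hHm : AEStronglyMeasurable H volume :=
    (Lp.aestronglyMeasurable _).inner (Lp.aestronglyMeasurable _)
  have hAH : ∀ᵐ ξ, (inner ℂ ((𝓕 G : L2 n) ξ) ((𝓕 (fracLaplacian γ u) : L2 n) ξ) : ℂ) =
      (((2 * Real.pi * ‖ξ‖) ^ (2 * γ) : ℝ) : ℂ) * H ξ := by
    rw [fourier_fracLaplacian hu]
    filter_upwards [hu.coeFn_toLp] with ξ h1
    rw [h1, fracSymbolMul, hH, ← smul_eq_mul, inner_smul_right]
  have hmHi : Integrable fun ξ => (((2 * Real.pi * ‖ξ‖) ^ (2 * γ) : ℝ) : ℂ) * H ξ :=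
    (L2.integrable_inner (𝕜 := ℂ) (𝓕 G : L2 n) (𝓕 (fracLaplacian γ u) : L2 n)).congr hAH
  have hinner : (inner ℂ G (fracLaplacian γ u) : ℂ) =
      ∫ ξ, (((2 * Real.pi * ‖ξ‖) ^ (2 * γ) : ℝ) : ℂ) * H ξ := by
    rw [← Lp.inner_fourier_eq, L2.inner_def]
    exact integral_congr_ae hAH
  have hkm := measurable_rieszKernel_mul_centralDiffSymbol (E := EuclideanSpace ℝ (Fin n)) γ M
  -- Fubini is justified by integrating in y first: the nonnegative kernel reproduces `c
  -- (2π‖ξ‖)^(2γ)`, and the result is integrable because u lies in the domain of `(-Δ)^γ`.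
  have hint : Integrable (Function.uncurry fun (ξ y : EuclideanSpace ℝ (Fin n)) =>
      ((rieszKernel γ y * centralDiffSymbol M y ξ : ℝ) : ℂ) * H ξ) (volume.prod volume) := by
    have hm : AEStronglyMeasurable (Function.uncurry fun (ξ y : EuclideanSpace ℝ (Fin n)) =>
        ((rieszKernel γ y * centralDiffSymbol M y ξ : ℝ) : ℂ) * H ξ) (volume.prod volume) :=
      (Complex.measurable_ofReal.comp (hkm.comp measurable_swap)).aestronglyMeasurable.mul
        hHm.comp_fst
    refine ⟨hm, ?_⟩
    rw [HasFiniteIntegral, lintegral_prod _ hm.enorm]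
    have h1 : ∀ ξ : EuclideanSpace ℝ (Fin n), ∫⁻ y, ‖Function.uncurry (fun ξ y =>
        ((rieszKernel γ y * centralDiffSymbol M y ξ : ℝ) : ℂ) * H ξ) (ξ, y)‖ₑ =
        ENNReal.ofReal c * ‖(((2 * Real.pi * ‖ξ‖) ^ (2 * γ) : ℝ) : ℂ) * H ξ‖ₑ := by
      intro ξ
      have h2 : ∀ y, ‖Function.uncurry (fun ξ y =>
          ((rieszKernel γ y * centralDiffSymbol M y ξ : ℝ) : ℂ) * H ξ) (ξ, y)‖ₑ =
          ENNReal.ofReal (rieszKernel γ y * centralDiffSymbol M y ξ) * ‖H ξ‖ₑ := by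
        intro y
        simp only [Function.uncurry_apply_pair, enorm_mul]
        rw [← ofReal_norm, Complex.norm_real, Real.norm_eq_abs, abs_of_nonneg
          (mul_nonneg (rieszKernel_nonneg γ y) (centralDiffSymbol_nonneg M y ξ))]
      simp_rw [h2]
      rw [lintegral_mul_const' _ _ enorm_ne_top, ← symbolIntegral, hJ, enorm_mul,
        ENNReal.ofReal_mul hc.le, mul_assoc]
      congr 2
      rw [← ofReal_norm, Complex.norm_real, Real.norm_eq_abs, abs_of_nonneg (by positivity)]
    simp_rw [h1]
    rw [lintegral_const_mul' _ _ ENNReal.ofReal_ne_top]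
    exact ENNReal.mul_lt_top ENNReal.ofReal_lt_top hmHi.hasFiniteIntegral
  -- The symbol of the difference is real, so by Plancherel it can be placed on G instead of u.
  have hswap : (c : ℂ) * inner ℂ G (fracLaplacian γ u) =
      ∫ y, (rieszKernel γ y : ℂ) * inner ℂ (centralDiffL2 M y G) u := by
    rw [hinner, ← integral_const_mul]
    calc _ = ∫ ξ, ∫ y, ((rieszKernel γ y * centralDiffSymbol M y ξ : ℝ) : ℂ) * H ξ := by
          refine integral_congr_ae (Filter.Eventually.of_forall fun ξ => ?_)
          simp only
          rw [integral_mul_const, integral_complex_ofReal,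
            integral_rieszKernel_mul_centralDiffSymbol hc.le (hJ ξ)]
          push_cast
          ring
      _ = ∫ y, ∫ ξ, ((rieszKernel γ y * centralDiffSymbol M y ξ : ℝ) : ℂ) * H ξ :=
          integral_integral_swap hint
      _ = _ := by
          refine integral_congr_ae (Filter.Eventually.of_forall fun y => ?_)
          simp only
          rw [← Lp.inner_fourier_eq, L2.inner_def, ← integral_const_mul]
          refine integral_congr_ae ?_
          filter_upwards [fourier_centralDiffL2 M y G] with ξ h1
          rw [h1, hH, ← smul_eq_mul (centralDiffSymbol M y ξ : ℂ), inner_smul_left,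
            Complex.conj_ofReal]
          push_cast
          ring
  have hpair : ∀ y, ‖(inner ℂ (centralDiffL2 M y G) u : ℂ)‖ₑ ≤
      ∫⁻ x, ‖centralDiff M y g x‖ₑ * ‖u x‖ₑ := by
    intro y
    rw [L2.inner_def]
    refine (enorm_integral_le_lintegral_enorm _).trans (le_of_eq (lintegral_congr_ae ?_))
    filter_upwards [coeFn_centralDiffL2 M y hg] with x h1
    rw [h1]
    rw [RCLike.inner_apply, enorm_mul, mul_comm]
    congr 1
    rw [← ofReal_norm, RCLike.norm_conj, ofReal_norm]
  have hbound : ENNReal.ofReal c * ‖(inner ℂ G (fracLaplacian γ u) : ℂ)‖ₑ ≤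
      ∫⁻ x, ‖u x‖ₑ * ∫⁻ y, ENNReal.ofReal (rieszKernel γ y) * ‖centralDiff M y g x‖ₑ := by
    calc _ = ‖(c : ℂ) * inner ℂ G (fracLaplacian γ u)‖ₑ := by
          rw [enorm_mul, ← ofReal_norm (c : ℂ), Complex.norm_real, Real.norm_eq_abs, abs_of_pos hc]
      _ ≤ ∫⁻ y, ‖(rieszKernel γ y : ℂ) * inner ℂ (centralDiffL2 M y G) u‖ₑ := by
          rw [hswap]
          exact enorm_integral_le_lintegral_enorm _
      _ ≤ ∫⁻ y, ∫⁻ x, ENNReal.ofReal (rieszKernel γ y) * (‖centralDiff M y g x‖ₑ * ‖u x‖ₑ) := by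
          refine lintegral_mono fun y => ?_
          rw [enorm_mul, ← ofReal_norm (rieszKernel γ y : ℂ), Complex.norm_real, Real.norm_eq_abs,
            abs_of_nonneg (rieszKernel_nonneg γ y), lintegral_const_mul' _ _ ENNReal.ofReal_ne_top]
          exact mul_le_mul_right (hpair y) _
      _ = ∫⁻ x, ∫⁻ y, ENNReal.ofReal (rieszKernel γ y) * (‖centralDiff M y g x‖ₑ * ‖u x‖ₑ) := by
          have h1 : AEMeasurable
              (fun z : EuclideanSpace ℝ (Fin n) × EuclideanSpace ℝ (Fin n) =>
                ENNReal.ofReal (rieszKernel γ z.1)) (volume.prod volume) :=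
            ((measurable_rieszKernel γ).ennreal_ofReal.comp measurable_fst).aemeasurable
          have h2 : AEMeasurable
              (fun z : EuclideanSpace ℝ (Fin n) × EuclideanSpace ℝ (Fin n) =>
                ‖centralDiff M z.1 g z.2‖ₑ) (volume.prod volume) :=
            (continuous_centralDiff hgc M).enorm.measurable.aemeasurable
          have h3 : AEMeasurable
              (fun z : EuclideanSpace ℝ (Fin n) × EuclideanSpace ℝ (Fin n) => ‖u z.2‖ₑ)
              (volume.prod volume) := (Lp.aestronglyMeasurable u).enorm.comp_snd
          exact lintegral_lintegral_swap (h1.mul (h2.mul h3))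
      _ = _ := by
          refine lintegral_congr fun x => ?_
          rw [← lintegral_const_mul' _ _ enorm_ne_top]
          refine lintegral_congr fun y => ?_
          ring
  calc _ = ENNReal.ofReal c⁻¹ * (ENNReal.ofReal c * ‖(inner ℂ G (fracLaplacian γ u) : ℂ)‖ₑ) := by
        rw [← mul_assoc, ← ENNReal.ofReal_mul (by positivity), inv_mul_cancel₀ hc.ne',
          ENNReal.ofReal_one, one_mul]
    _ ≤ _ := mul_le_mul_right hbound _

end Duality

/-! ### The estimate for dilated weights -/

section DilatedWeight

variable {n : ℕ}

lemma MeasureTheory.Integrable.memLp_two_of_bound {α : Type*} [MeasurableSpace α] {μ : Measure α}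
    {f : α → ℝ} (hf : Integrable f μ) {C : ℝ} (hC : ∀ x, |f x| ≤ C) :
    MemLp (fun x => (f x : ℂ)) 2 μ := by
  have h2 : MemLp f 2 μ := by
    rw [memLp_two_iff_integrable_sq hf.aestronglyMeasurable]
    refine (hf.abs.const_mul C).mono' (hf.aestronglyMeasurable.pow 2)
      (Filter.Eventually.of_forall fun x => ?_)
    rw [Real.norm_eq_abs, abs_pow, sq]
    exact mul_le_mul_of_nonneg_right (hC x) (abs_nonneg _)
  exact h2.ofReal

lemma integral_mul_ofReal_eq_inner {f : L2 n} {g : EuclideanSpace ℝ (Fin n) → ℝ}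
    (hg : MemLp (fun x => (g x : ℂ)) 2 volume) :
    ∫ x, f x * (g x : ℂ) = inner ℂ (hg.toLp fun x => (g x : ℂ)) f := by
  rw [L2.inner_def]
  refine integral_congr_ae ?_
  filter_upwards [hg.coeFn_toLp] with x hx
  rw [hx, RCLike.inner_apply, Complex.conj_ofReal]

lemma enorm_integral_mul_ofReal_le (f : L2 n) {g : EuclideanSpace ℝ (Fin n) → ℝ}
    (hg0 : ∀ x, 0 ≤ g x) :
    ‖∫ x, f x * (g x : ℂ)‖ₑ ≤ ∫⁻ x, ‖f x‖ₑ * ENNReal.ofReal (g x) := by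
  refine (enorm_integral_le_lintegral_enorm _).trans (le_of_eq (lintegral_congr fun x => ?_))
  rw [enorm_mul, ← ofReal_norm (g x : ℂ), Complex.norm_real, Real.norm_eq_abs,
    abs_of_nonneg (hg0 x)]

lemma IsSmoothWeight.memLp_two_dilate {q : ℝ} (hq : (n : ℝ) < q)
    {ψ : EuclideanSpace ℝ (Fin n) → ℝ} (h : IsSmoothWeight q ψ) {R : ℝ} (hR : 0 < R) :
    MemLp (fun x => (ψ (R⁻¹ • x) : ℂ)) 2 volume := by
  have hq' : (Module.finrank ℝ (EuclideanSpace ℝ (Fin n)) : ℝ) < q := by simpa using hq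
  have hi : Integrable fun x => ψ (R⁻¹ • x) :=
    (integrable_comp_smul_iff volume ψ (inv_ne_zero hR.ne')).2 (h.integrable hq')
  refine hi.memLp_two_of_bound (C := 2 ^ q) fun x => ?_
  rw [abs_of_pos (h.pos _)]
  exact h.le_two_rpow ((Nat.cast_nonneg n).trans hq.le) _

/-- Testing a fractional Laplacian of order `γ` with a dilated smooth weight gains `R ^ (-2γ)`. -/
theorem IsSmoothWeight.enorm_integral_fracLaplacian_mul_le (hn : n ≠ 0) {γ q : ℝ} (hγ : 0 ≤ γ)
    (hd : (n : ℝ) < q) (hq : γ ≠ 0 → q ≤ n + 2 * γ) {ψ : EuclideanSpace ℝ (Fin n) → ℝ}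
    (h : IsSmoothWeight q ψ) :
    ∃ C : ℝ, 0 ≤ C ∧ ∀ R : ℝ, 0 < R → ∀ u : L2 n, MemLp (fracSymbolMul γ u) 2 volume →
      ‖∫ x, fracLaplacian γ u x * (ψ (R⁻¹ • x) : ℂ)‖ₑ ≤
        ENNReal.ofReal (C * R ^ (-(2 * γ))) * ∫⁻ x, ‖u x‖ₑ * ENNReal.ofReal (ψ (R⁻¹ • x)) := by
  -- Order zero is separate: the kernel `‖y‖^(-n)` is not integrable at infinity, but the operator
  -- is the identity and the bound is trivial.
  rcases hγ.eq_or_lt with rfl | hγ0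
  · refine ⟨1, zero_le_one, fun R hR u _ => ?_⟩
    rw [fracLaplacian_zero_left]
    simpa using enorm_integral_mul_ofReal_le u (g := fun x => ψ (R⁻¹ • x)) fun x => (h.pos _).le
  · have : Nonempty (Fin n) := ⟨⟨0, Nat.pos_of_ne_zero hn⟩⟩
    have hdim : Module.finrank ℝ (EuclideanSpace ℝ (Fin n)) = n := by simp
    obtain ⟨M, hM⟩ := exists_nat_gt γ
    obtain ⟨C₁, hC₁, h₁⟩ := enorm_inner_fracLaplacian_le (n := n) hγ0 hM
    obtain ⟨C₂, hC₂, h₂⟩ := h.lintegral_rieszKernel_mul_centralDiff_le (γ := γ) hM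
      (by rwa [hdim]) (by rw [hdim]; exact hq hγ0.ne')
    refine ⟨(C₁ * C₂).toReal, ENNReal.toReal_nonneg, fun R hR u hu => ?_⟩
    have hg : MemLp (fun x => (ψ (R⁻¹ • x) : ℂ)) 2 volume := h.memLp_two_dilate hd hR
    have hψc := h.contDiff.continuous
    rw [integral_mul_ofReal_eq_inner (g := fun x => ψ (R⁻¹ • x)) hg]
    refine (h₁ u hu _ (by fun_prop) hg).trans ?_
    rw [ENNReal.ofReal_mul ENNReal.toReal_nonneg, ENNReal.ofReal_toReal (by finiteness), mul_assoc,
      mul_assoc]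
    refine mul_le_mul_right ?_ _
    rw [← lintegral_const_mul' _ _ ENNReal.ofReal_ne_top, ← lintegral_const_mul' _ _ hC₂]
    refine lintegral_mono fun x => ?_
    have h3 : ∫⁻ y, ENNReal.ofReal (rieszKernel γ y) *
        ‖centralDiff M y (fun x => (ψ (R⁻¹ • x) : ℂ)) x‖ₑ =
        ∫⁻ y, ENNReal.ofReal (rieszKernel γ y * |centralDiff M y (fun x => ψ (R⁻¹ • x)) x|) := by
      refine lintegral_congr fun y => ?_
      rw [ENNReal.ofReal_mul (rieszKernel_nonneg γ y), ← Real.norm_eq_abs, ofReal_norm,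
        ← ofReal_norm, ← ofReal_norm, ← Complex.norm_real]
      congr 3
      simp [centralDiff]
    rw [h3, lintegral_rieszKernel_mul_centralDiff_comp_smul hψc hR]
    calc _ ≤ ‖u x‖ₑ * (ENNReal.ofReal (R ^ (-(2 * γ))) *
          (C₂ * ENNReal.ofReal (ψ (R⁻¹ • x)))) :=
          mul_le_mul_right (mul_le_mul_right (h₂ _) _) _
      _ = _ := by ring

end DilatedWeight

/-! ### Consequences of Sobolev regularity -/

section Bessel

variable {n : ℕ}

/-- The weight `(1 + ‖ξ‖²)^(s/2)` is inverted at the level of tempered distributions. Its inverse is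
bounded for `s ≥ 0`, hence acts on L², and L² embeds injectively into tempered distributions. -/
lemma fourier_eq_of_besselPotential_eq {s : ℝ} (hs : 0 ≤ s) {u v : L2 n}
    (h : TemperedDistribution.besselPotential (EuclideanSpace ℝ (Fin n)) ℂ s
      (Lp.toTemperedDistribution u) = Lp.toTemperedDistribution v) :
    (𝓕 u : L2 n) =ᵐ[volume]
      fun ξ => (((1 + ‖ξ‖ ^ 2) ^ (-(s / 2)) : ℝ) : ℂ) * (𝓕 v : L2 n) ξ := by
  set w : EuclideanSpace ℝ (Fin n) → ℂ := fun ξ => (((1 + ‖ξ‖ ^ 2) ^ (s / 2) : ℝ) : ℂ) with hw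
  set w' : EuclideanSpace ℝ (Fin n) → ℂ := fun ξ => (((1 + ‖ξ‖ ^ 2) ^ (-(s / 2)) : ℝ) : ℂ) with hw'
  have hwt : w.HasTemperateGrowth := by fun_prop
  have hwt' : w'.HasTemperateGrowth := by fun_prop
  have hwb : MemLp w' ⊤ volume := by
    refine memLp_top_of_bound hwt'.1.continuous.aestronglyMeasurable 1
      (Filter.Eventually.of_forall fun ξ => ?_)
    rw [hw', Complex.norm_real, Real.norm_eq_abs, abs_of_nonneg (by positivity)]
    exact Real.rpow_le_one_of_one_le_of_nonpos (by nlinarith [norm_nonneg ξ]) (by linarith)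
  have h1 : (Lp.toTemperedDistribution (𝓕 v : L2 n)) =
      TemperedDistribution.smulLeftCLM ℂ w (Lp.toTemperedDistribution (𝓕 u : L2 n)) := by
    rw [← Lp.fourier_toTemperedDistribution_eq, ← Lp.fourier_toTemperedDistribution_eq, ← h,
      TemperedDistribution.fourier_besselPotential_eq_smulLeftCLM_fourier_apply]
  have h2 : Lp.toTemperedDistribution ((hwb.toLp w' • (𝓕 v : L2 n) : L2 n)) =
      Lp.toTemperedDistribution (𝓕 u : L2 n) := by
    rw [Lp.toTemperedDistribution_smul_eq hwt' hwb, h1,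
      TemperedDistribution.smulLeftCLM_smulLeftCLM_apply hwt hwt']
    have h3 : w * w' = fun _ => 1 := by
      ext ξ
      rw [Pi.mul_apply, hw, hw', ← Complex.ofReal_mul, ← Real.rpow_add (by positivity)]
      simp
    rw [h3, TemperedDistribution.smulLeftCLM_const, one_smul]
  have h4 : (hwb.toLp w' • (𝓕 v : L2 n) : L2 n) = (𝓕 u : L2 n) := by
    have := Lp.ker_toTemperedDistributionCLM_eq_bot (E := EuclideanSpace ℝ (Fin n)) (F := ℂ)
      (μ := volume) (p := 2)
    exact LinearMap.ker_eq_bot.1 this h2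
  rw [← h4]
  filter_upwards [Lp.coeFn_lpSMul (r := 2) (hwb.toLp w') (𝓕 v : L2 n), hwb.coeFn_toLp]
    with ξ h5 h6
  rw [h5, Pi.smul_apply', h6, smul_eq_mul]

lemma norm_sub_le_of_besselPotential_eq {s : ℝ} (hs : 0 ≤ s) {u v u' v' : L2 n}
    (h : TemperedDistribution.besselPotential (EuclideanSpace ℝ (Fin n)) ℂ s
      (Lp.toTemperedDistribution u) = Lp.toTemperedDistribution v)
    (h' : TemperedDistribution.besselPotential (EuclideanSpace ℝ (Fin n)) ℂ s
      (Lp.toTemperedDistribution u') = Lp.toTemperedDistribution v') :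
    ‖u - u'‖ ≤ ‖v - v'‖ := by
  have e1 : ‖u - u'‖ = ‖(𝓕 u : L2 n) - 𝓕 u'‖ := by
    rw [← Lp.norm_fourier_eq (u - u')]
    exact congrArg norm ((Lp.fourierTransformₗᵢ _ ℂ).map_sub u u')
  have e2 : ‖v - v'‖ = ‖(𝓕 v : L2 n) - 𝓕 v'‖ := by
    rw [← Lp.norm_fourier_eq (v - v')]
    exact congrArg norm ((Lp.fourierTransformₗᵢ _ ℂ).map_sub v v')
  rw [e1, e2]
  refine Lp.norm_le_norm_of_ae_le ?_
  filter_upwards [fourier_eq_of_besselPotential_eq hs h, fourier_eq_of_besselPotential_eq hs h',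
    Lp.coeFn_sub (𝓕 u : L2 n) (𝓕 u'), Lp.coeFn_sub (𝓕 v : L2 n) (𝓕 v')] with ξ h1 h2 h3 h4
  rw [h3, h4, Pi.sub_apply, Pi.sub_apply, h1, h2, ← mul_sub, norm_mul, Complex.norm_real,
    Real.norm_eq_abs, abs_of_nonneg (by positivity)]
  refine mul_le_of_le_one_left (norm_nonneg _) ?_
  exact Real.rpow_le_one_of_one_le_of_nonpos (by nlinarith [norm_nonneg ξ]) (by linarith)

/-- This is `‖ξ‖^(2γ) ≤ (1 + ‖ξ‖²)^(s/2)` on the Fourier side. The factor `(2π)^(2γ)` appears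
because the Bessel weight is expressed in `‖ξ‖`, the Laplacian in `2π‖ξ‖`. -/
lemma memLp_fracSymbolMul_and_norm_fracLaplacian_le {s γ : ℝ} (hγ : 0 ≤ γ) (hγs : 2 * γ ≤ s)
    {u v : L2 n}
    (h : TemperedDistribution.besselPotential (EuclideanSpace ℝ (Fin n)) ℂ s
      (Lp.toTemperedDistribution u) = Lp.toTemperedDistribution v) :
    MemLp (fracSymbolMul γ u) 2 volume ∧
      ‖fracLaplacian γ u‖ ≤ (2 * Real.pi) ^ (2 * γ) * ‖v‖ := by
  have hle : ∀ᵐ ξ, ‖fracSymbolMul γ u ξ‖ ≤ (2 * Real.pi) ^ (2 * γ) * ‖(𝓕 v : L2 n) ξ‖ := by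
    filter_upwards [fourier_eq_of_besselPotential_eq (by linarith) h] with ξ h1
    rw [fracSymbolMul, h1, norm_mul, norm_mul, Complex.norm_real, Complex.norm_real,
      Real.norm_eq_abs, Real.norm_eq_abs, abs_of_nonneg (by positivity),
      abs_of_nonneg (by positivity), ← mul_assoc]
    refine mul_le_mul_of_nonneg_right ?_ (norm_nonneg _)
    rw [Real.mul_rpow (by positivity) (norm_nonneg _), mul_assoc]
    refine mul_le_of_le_one_right (by positivity) ?_
    have h2 : ‖ξ‖ ^ (2 * γ) ≤ (1 + ‖ξ‖ ^ 2) ^ (s / 2) := by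
      calc ‖ξ‖ ^ (2 * γ) = (‖ξ‖ ^ 2) ^ γ := by
            rw [Real.rpow_mul (norm_nonneg _), Real.rpow_two]
        _ ≤ (1 + ‖ξ‖ ^ 2) ^ γ := Real.rpow_le_rpow (by positivity) (by linarith) hγ
        _ ≤ _ := Real.rpow_le_rpow_of_exponent_le (by nlinarith [norm_nonneg ξ]) (by linarith)
    rw [Real.rpow_neg (by positivity), ← div_eq_mul_inv]
    exact div_le_one_of_le₀ h2 (by positivity)
  have hm : AEStronglyMeasurable (fracSymbolMul γ u) volume := by
    unfold fracSymbolMul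
    refine AEStronglyMeasurable.mul ?_ (Lp.aestronglyMeasurable _)
    exact (by fun_prop : Measurable fun ξ : EuclideanSpace ℝ (Fin n) =>
      (((2 * Real.pi * ‖ξ‖) ^ (2 * γ) : ℝ) : ℂ)).aestronglyMeasurable
  have hmem : MemLp (fracSymbolMul γ u) 2 volume := (Lp.memLp (𝓕 v : L2 n)).of_le_mul hm hle
  refine ⟨hmem, ?_⟩
  rw [← Lp.norm_fourier_eq (fracLaplacian γ u), ← Lp.norm_fourier_eq v, fourier_fracLaplacian hmem]
  refine Lp.norm_le_mul_norm_of_ae_le_mul ?_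
  filter_upwards [hmem.coeFn_toLp, hle] with ξ h1 h2
  rwa [h1]

lemma Icc_subset_timeInterval {T : EReal} {τ : ℝ} (hτ : (τ : EReal) < T) :
    Set.Icc 0 τ ⊆ timeInterval T := fun _ ht =>
  ⟨ht.1, (EReal.coe_le_coe_iff.2 ht.2).trans_lt hτ⟩

lemma ContinuousInSobolev.continuousOn {s : ℝ} (hs : 0 ≤ s) {T : EReal} {u : ℝ → L2 n}
    (h : ContinuousInSobolev s T u) : ContinuousOn u (timeInterval T) := by
  obtain ⟨v, hv, huv⟩ := h
  intro t ht
  rw [ContinuousWithinAt, tendsto_iff_norm_sub_tendsto_zero]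
  refine squeeze_zero' (Filter.Eventually.of_forall fun _ => norm_nonneg _) ?_
    (tendsto_iff_norm_sub_tendsto_zero.1 (hv t ht))
  filter_upwards [self_mem_nhdsWithin] with t' ht'
  exact norm_sub_le_of_besselPotential_eq hs (huv t' ht') (huv t ht)

lemma ContinuousInSobolev.memLp_fracSymbolMul {s γ : ℝ} (hγ : 0 ≤ γ) (hγs : 2 * γ ≤ s) {T : EReal}
    {u : ℝ → L2 n} (h : ContinuousInSobolev s T u) {t : ℝ} (ht : t ∈ timeInterval T) :
    MemLp (fracSymbolMul γ (u t)) 2 volume := by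
  obtain ⟨v, -, huv⟩ := h
  exact (memLp_fracSymbolMul_and_norm_fracLaplacian_le hγ hγs (huv t ht)).1

lemma ContinuousInSobolev.exists_norm_fracLaplacian_le {s γ : ℝ} (hγ : 0 ≤ γ) (hγs : 2 * γ ≤ s)
    {T : EReal} {u : ℝ → L2 n} (h : ContinuousInSobolev s T u) {τ : ℝ} (hτ : (τ : EReal) < T) :
    ∃ B : ℝ, 0 ≤ B ∧ ∀ t ∈ Set.Icc 0 τ, ‖fracLaplacian γ (u t)‖ ≤ B := by
  obtain ⟨v, hv, huv⟩ := h
  obtain ⟨B, hB⟩ := isCompact_Icc.exists_bound_of_continuousOn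
    (hv.mono (Icc_subset_timeInterval hτ))
  refine ⟨(2 * Real.pi) ^ (2 * γ) * |B|, by positivity, fun t ht => ?_⟩
  refine (memLp_fracSymbolMul_and_norm_fracLaplacian_le hγ hγs
    (huv t (Icc_subset_timeInterval hτ ht))).2.trans ?_
  exact mul_le_mul_of_nonneg_left ((hB t ht).trans (le_abs_self B)) (by positivity)

end Bessel

/-! ### Measurability in time of the power functional -/

section PowerFunctional

variable {α : Type*} [MeasurableSpace α] {μ : Measure α}

/-- An L² convergent sequence has an almost everywhere convergent subsequence, so Fatou's lemma
shows that sublevel sets are sequentially closed. Composed with the continuous curve u, this gives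
measurability in t although no joint measurability of `u t x` is available. -/
lemma lowerSemicontinuous_lintegral_enorm_rpow_mul {p : ℝ} {g : α → ℝ}
    (hg : Measurable g) : LowerSemicontinuous fun f : Lp ℂ 2 μ =>
      ∫⁻ x, ‖f x‖ₑ ^ p * ENNReal.ofReal (g x) ∂μ := by
  rw [lowerSemicontinuous_iff_isClosed_preimage]
  intro c
  refine IsSeqClosed.isClosed fun f f₀ hf hlim => ?_
  obtain ⟨ns, -, hns⟩ := (tendstoInMeasure_of_tendsto_Lp hlim).exists_seq_tendsto_ae
  have h1 : ∫⁻ x, ‖f₀ x‖ₑ ^ p * ENNReal.ofReal (g x) ∂μ ≤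
      ∫⁻ x, Filter.liminf (fun k => ‖f (ns k) x‖ₑ ^ p * ENNReal.ofReal (g x)) Filter.atTop ∂μ := by
    refine lintegral_mono_ae ?_
    filter_upwards [hns] with x hx
    refine le_of_eq (Filter.Tendsto.liminf_eq ?_).symm
    refine ENNReal.Tendsto.mul_const ?_ (Or.inr ENNReal.ofReal_ne_top)
    exact (ENNReal.continuous_rpow_const.tendsto _).comp hx.enorm
  refine h1.trans ((lintegral_liminf_le' fun k => ?_).trans ?_)
  · exact ((Lp.aestronglyMeasurable _).enorm.pow_const p).mul hg.ennreal_ofReal.aemeasurable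
  · exact Filter.liminf_le_of_le (by isBoundedDefault) fun b hb =>
      let ⟨k, hk⟩ := hb.exists
      hk.trans (hf (ns k))

lemma aemeasurable_lintegral_enorm_rpow_mul {p : ℝ} {g : α → ℝ} (hg : Measurable g) {s : Set ℝ}
    (hs : MeasurableSet s) {u : ℝ → Lp ℂ 2 μ} (hu : ContinuousOn u s) :
    AEMeasurable (fun t => ∫⁻ x, ‖u t x‖ₑ ^ p * ENNReal.ofReal (g x) ∂μ) (volume.restrict s) := by
  let : MeasurableSpace (Lp ℂ 2 μ) := borel _
  have : BorelSpace (Lp ℂ 2 μ) := ⟨rfl⟩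
  exact (lowerSemicontinuous_lintegral_enorm_rpow_mul hg).measurable.comp_aemeasurable
    (hu.aemeasurable hs)

end PowerFunctional

/-! ### Time cutoffs adapted to the power p -/

section TimeCutoff

/-- A smooth cutoff in time whose first two derivatives are controlled by its power `1 / p`. -/
structure IsTimeCutoff (p τ D₁ D₂ : ℝ) (η : ℝ → ℝ) : Prop where
  contDiff : ContDiff ℝ ∞ η
  nonneg : ∀ t, 0 ≤ η t
  le_one : ∀ t, η t ≤ 1
  apply_zero : η 0 = 1
  eq_zero : ∀ t, τ < |t| → η t = 0
  deriv_le : ∀ t, |deriv η t| ≤ D₁ * η t ^ (1 / p)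
  iteratedDeriv_two_le : ∀ t, |iteratedDeriv 2 η t| ≤ D₂ * η t ^ (1 / p)

lemma exists_isTimeCutoff {p : ℝ} (hp : 1 < p) : ∃ C : ℝ, 0 ≤ C ∧ ∀ τ : ℝ, 0 < τ →
    ∃ η : ℝ → ℝ, IsTimeCutoff p τ (C * τ⁻¹) (C * τ⁻¹ ^ 2) η := by
  let h : ContDiffBump (0 : ℝ) := ⟨1 / 2, 1, by norm_num, by norm_num⟩
  have hsm : ContDiff ℝ ∞ h := h.contDiff
  have hd : Differentiable ℝ h := hsm.differentiable (by simp)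
  have hsm1 : ContDiff ℝ ∞ (deriv h) := (contDiff_infty_iff_deriv.1 hsm).2
  have hd1 : Differentiable ℝ (deriv h) := hsm1.differentiable (by simp)
  have hsm2 : ContDiff ℝ ∞ (deriv (deriv h)) := (contDiff_infty_iff_deriv.1 hsm1).2
  obtain ⟨D₁, hD₁⟩ := h.hasCompactSupport.deriv.exists_bound_of_continuous hsm1.continuous
  obtain ⟨D₂, hD₂⟩ := h.hasCompactSupport.deriv.deriv.exists_bound_of_continuous hsm2.continuous
  have hD₁0 : 0 ≤ D₁ := (norm_nonneg _).trans (hD₁ 0)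
  have hD₂0 : 0 ≤ D₂ := (norm_nonneg _).trans (hD₂ 0)
  -- The cutoff is `h^(m + 2)`. Two derivatives leave at least `h^m`, and `h^m ≤ (h^(m + 2))^(1/p)`
  -- requires `(m + 2)/p ≤ m`, that is `m ≥ 2/(p - 1)`.
  obtain ⟨m, hm⟩ := exists_nat_ge (2 / (p - 1))
  have hp0 : 0 < p := by linarith
  have hml : ((m + 2 : ℕ) : ℝ) * (1 / p) ≤ m := by
    rw [div_le_iff₀ (by linarith)] at hm
    rw [mul_one_div, div_le_iff₀ hp0]
    push_cast
    linarith
  have hpow : ∀ t, h t ^ m ≤ (h t ^ (m + 2)) ^ (1 / p) := by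
    intro t
    rw [← Real.rpow_natCast, ← Real.rpow_natCast, ← Real.rpow_mul h.nonneg]
    exact Real.rpow_le_rpow_of_exponent_ge' h.nonneg h.le_one (by positivity) hml
  have hpow1 : ∀ t, h t ^ (m + 1) ≤ (h t ^ (m + 2)) ^ (1 / p) := fun t =>
    (pow_le_pow_of_le_one h.nonneg h.le_one (Nat.le_succ m)).trans (hpow t)
  have hder1 : deriv (fun t => h t ^ (m + 2)) = fun t => (m + 2 : ℝ) * h t ^ (m + 1) * deriv h t := by
    ext t
    rw [((hd t).hasDerivAt.fun_pow (m + 2)).deriv]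
    push_cast
    norm_num
  have hder2 : deriv (deriv fun t => h t ^ (m + 2)) = fun t =>
      (m + 2 : ℝ) * (m + 1) * h t ^ m * deriv h t ^ 2 +
        (m + 2 : ℝ) * h t ^ (m + 1) * deriv (deriv h) t := by
    ext t
    rw [hder1, ((((hd t).hasDerivAt.fun_pow (m + 1)).const_mul (m + 2 : ℝ)).fun_mul
      (hd1 t).hasDerivAt).deriv]
    push_cast
    norm_num
    ring
  set C : ℝ := (m + 2) * D₁ + ((m + 2) * (m + 1) * D₁ ^ 2 + (m + 2) * D₂) with hC
  have hb1 : ∀ t, |deriv (fun t => h t ^ (m + 2)) t| ≤ C * (h t ^ (m + 2)) ^ (1 / p) := by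
    intro t
    have hnn : 0 ≤ (h t ^ (m + 2)) ^ (1 / p) := Real.rpow_nonneg (pow_nonneg h.nonneg _) _
    have e := hD₁ t
    rw [Real.norm_eq_abs] at e
    rw [hder1]
    simp only
    rw [abs_mul, abs_mul, abs_of_nonneg (pow_nonneg h.nonneg (m + 1)),
      abs_of_nonneg (show (0 : ℝ) ≤ m + 2 by positivity)]
    calc _ ≤ (m + 2 : ℝ) * (h t ^ (m + 2)) ^ (1 / p) * D₁ := by
          gcongr
          exact hpow1 t
      _ = (m + 2 : ℝ) * D₁ * (h t ^ (m + 2)) ^ (1 / p) := by ring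
      _ ≤ _ := mul_le_mul_of_nonneg_right (le_add_of_nonneg_right (by positivity)) hnn
  have hb2 : ∀ t, |deriv (deriv fun t => h t ^ (m + 2)) t| ≤ C * (h t ^ (m + 2)) ^ (1 / p) := by
    intro t
    have hnn : 0 ≤ (h t ^ (m + 2)) ^ (1 / p) := Real.rpow_nonneg (pow_nonneg h.nonneg _) _
    have e := hD₁ t
    have e2 := hD₂ t
    rw [Real.norm_eq_abs] at e e2
    rw [hder2]
    simp only
    refine (abs_add_le _ _).trans ?_
    rw [abs_mul, abs_mul, abs_mul, abs_mul, abs_mul, abs_of_nonneg (pow_nonneg h.nonneg (m + 1)),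
      abs_of_nonneg (pow_nonneg h.nonneg m), abs_pow,
      abs_of_nonneg (show (0 : ℝ) ≤ m + 2 by positivity),
      abs_of_nonneg (show (0 : ℝ) ≤ m + 1 by positivity)]
    calc _ ≤ (m + 2 : ℝ) * (m + 1) * (h t ^ (m + 2)) ^ (1 / p) * D₁ ^ 2 +
          (m + 2) * (h t ^ (m + 2)) ^ (1 / p) * D₂ := by
          gcongr
          · exact hpow t
          · exact hpow1 t
      _ = ((m + 2 : ℝ) * (m + 1) * D₁ ^ 2 + (m + 2) * D₂) * (h t ^ (m + 2)) ^ (1 / p) := by ring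
      _ ≤ _ := mul_le_mul_of_nonneg_right (le_add_of_nonneg_left (by positivity)) hnn
  refine ⟨C, by positivity, fun τ hτ => ⟨fun t => h (τ⁻¹ * t) ^ (m + 2), ?_, fun t => ?_, fun t => ?_,
    ?_, fun t ht => ?_, fun t => ?_, fun t => ?_⟩⟩
  · exact (hsm.comp (contDiff_const.mul contDiff_id)).pow _
  · exact pow_nonneg h.nonneg _
  · exact pow_le_one₀ h.nonneg h.le_one
  · rw [mul_zero, h.one_of_mem_closedBall (by simp [h]), one_pow]
  · have : h (τ⁻¹ * t) = 0 := by
      refine h.zero_of_le_dist ?_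
      rw [dist_zero_right, Real.norm_eq_abs, abs_mul, abs_of_pos (inv_pos.2 hτ), inv_mul_eq_div,
        le_div_iff₀ hτ]
      simpa [h] using ht.le
    rw [this, zero_pow (by omega)]
  · have e : deriv (fun t => h (τ⁻¹ * t) ^ (m + 2)) t =
        τ⁻¹ * deriv (fun t => h t ^ (m + 2)) (τ⁻¹ * t) :=
      deriv_comp_mul_left τ⁻¹ (fun t => h t ^ (m + 2)) t
    rw [e, abs_mul, abs_of_pos (inv_pos.2 hτ)]
    calc _ ≤ τ⁻¹ * (C * (h (τ⁻¹ * t) ^ (m + 2)) ^ (1 / p)) :=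
          mul_le_mul_of_nonneg_left (hb1 _) (inv_pos.2 hτ).le
      _ = _ := by ring
  · have e : iteratedDeriv 2 (fun t => h (τ⁻¹ * t) ^ (m + 2)) t =
        τ⁻¹ ^ 2 * iteratedDeriv 2 (fun t => h t ^ (m + 2)) (τ⁻¹ * t) := by
      have := congrFun (iteratedDeriv_comp_const_mul (n := 2) (f := fun t => h t ^ (m + 2))
        (contDiff_infty.1 (hsm.pow (m + 2)) 2) τ⁻¹) t
      simpa using this
    have e2 : iteratedDeriv 2 (fun t => h t ^ (m + 2)) = deriv (deriv fun t => h t ^ (m + 2)) := by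
      rw [iteratedDeriv_succ, iteratedDeriv_one]
    rw [e, e2, abs_mul, abs_of_nonneg (by positivity)]
    calc _ ≤ τ⁻¹ ^ 2 * (C * (h (τ⁻¹ * t) ^ (m + 2)) ^ (1 / p)) :=
          mul_le_mul_of_nonneg_left (hb2 _) (by positivity)
      _ = _ := by ring

end TimeCutoff

/-! ### Young's inequality in absorbing form -/

section Young

/-- Young's inequality with `a^(1/p)` attached to X; the factors `1/p` and `1/q` are discarded. The
coefficient 1 of `X^p a` is admissible because the same term occurs in the tested equation with
coefficient 1 and cancels. -/
lemma ENNReal.mul_ofReal_le_rpow_mul_add {p q : ℝ} (hpq : p.HolderConjugate q) (X : ENNReal)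
    {a s : ℝ} (ha : 0 ≤ a) (hs : 0 ≤ s) :
    ENNReal.ofReal (s * a ^ (1 / p)) * X ≤ X ^ p * ENNReal.ofReal a + ENNReal.ofReal (s ^ q) := by
  have h := ENNReal.young_inequality (X * ENNReal.ofReal (a ^ (1 / p))) (ENNReal.ofReal s) hpq
  have h1 : (X * ENNReal.ofReal (a ^ (1 / p))) ^ p = X ^ p * ENNReal.ofReal a := by
    rw [ENNReal.mul_rpow_of_nonneg _ _ hpq.nonneg,
      ENNReal.ofReal_rpow_of_nonneg (by positivity) hpq.nonneg, ← Real.rpow_mul ha,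
      one_div_mul_cancel hpq.ne_zero, Real.rpow_one]
  rw [h1, ENNReal.ofReal_rpow_of_nonneg hs hpq.symm.nonneg] at h
  calc _ = X * ENNReal.ofReal (a ^ (1 / p)) * ENNReal.ofReal s := by
        rw [ENNReal.ofReal_mul hs]; ring
    _ ≤ _ := h
    _ ≤ _ := by
        refine add_le_add (ENNReal.div_le_of_le_mul ?_) (ENNReal.div_le_of_le_mul ?_)
        · exact le_mul_of_one_le_right' (ENNReal.one_le_ofReal.2 hpq.lt.le)
        · exact le_mul_of_one_le_right' (ENNReal.one_le_ofReal.2 hpq.symm.lt.le)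

end Young

/-! ### Exhausting a weight by compactly supported functions -/

section SpaceCutoff

variable {E : Type*} [NormedAddCommGroup E] [InnerProductSpace ℝ E] [FiniteDimensional ℝ E]

/-- `g k` is an increasing sequence of nonnegative smooth compactly supported functions that
exhausts `Ψ`. -/
structure IsExhaustion (Ψ : E → ℝ) (g : ℕ → E → ℝ) : Prop where
  contDiff : ∀ k, ContDiff ℝ ∞ (g k)
  hasCompactSupport : ∀ k, HasCompactSupport (g k)
  nonneg : ∀ k x, 0 ≤ g k x
  le : ∀ k x, g k x ≤ Ψ x
  mono : ∀ x, Monotone fun k => g k x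
  tendsto : ∀ x, Filter.Tendsto (fun k => g k x) Filter.atTop (nhds (Ψ x))

lemma exists_isExhaustion {Ψ : E → ℝ} (hΨ : ContDiff ℝ ∞ Ψ) (h0 : ∀ x, 0 ≤ Ψ x) :
    ∃ g : ℕ → E → ℝ, IsExhaustion Ψ g := by
  -- The radii `k + 1` and `k + 2` are chosen so that each bump equals 1 on the support of the
  -- previous one, which makes the sequence monotone.
  let χ : ℕ → ContDiffBump (0 : E) := fun k => ⟨k + 1, k + 2, by positivity, by linarith⟩
  have hone : ∀ (k : ℕ) (x : E), ‖x‖ ≤ k + 1 → χ k x = 1 := fun k x hx =>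
    (χ k).one_of_mem_closedBall (by simpa [χ] using hx)
  refine ⟨fun k x => χ k x * Ψ x, fun k => (χ k).contDiff.mul hΨ, fun k => ?_, fun k x => ?_,
    fun k x => ?_, fun x => ?_, fun x => ?_⟩
  · exact (χ k).hasCompactSupport.mul_right
  · exact mul_nonneg (χ k).nonneg (h0 x)
  · exact mul_le_of_le_one_left (h0 x) (χ k).le_one
  · refine monotone_nat_of_le_succ fun k => mul_le_mul_of_nonneg_right ?_ (h0 x)
    rcases le_or_gt ‖x‖ (k + 2) with h | h
    · rw [hone (k + 1) x (by push_cast; linarith)]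
      exact (χ k).le_one
    · rw [(χ k).zero_of_le_dist (by simpa [χ] using h.le)]
      exact (χ (k + 1)).nonneg
  · obtain ⟨N, hN⟩ := exists_nat_ge ‖x‖
    refine tendsto_const_nhds.congr' ?_
    filter_upwards [Filter.eventually_ge_atTop N] with k hk
    have : (N : ℝ) ≤ k := by exact_mod_cast hk
    rw [hone k x (by linarith), one_mul]

lemma IsExhaustion.abs_le {Ψ : E → ℝ} {g : ℕ → E → ℝ} (h : IsExhaustion Ψ g) (k : ℕ) (x : E) :
    |g k x| ≤ Ψ x := by
  rw [abs_of_nonneg (h.nonneg k x)]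
  exact h.le k x

variable [MeasurableSpace E] [BorelSpace E]

lemma IsExhaustion.memLp {Ψ : E → ℝ} {g : ℕ → E → ℝ} (h : IsExhaustion Ψ g)
    (hΨ : MemLp (fun x => (Ψ x : ℂ)) 2 volume) (k : ℕ) :
    MemLp (fun x => (g k x : ℂ)) 2 volume := by
  have hc := (h.contDiff k).continuous
  refine hΨ.mono (by fun_prop) (Filter.Eventually.of_forall fun x => ?_)
  rw [Complex.norm_real, Complex.norm_real, Real.norm_eq_abs, Real.norm_eq_abs]
  exact (h.abs_le k x).trans (le_abs_self _)

lemma IsExhaustion.tendsto_norm_toLp_sub {Ψ : E → ℝ} {g : ℕ → E → ℝ} (h : IsExhaustion Ψ g)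
    (hΨ : MemLp (fun x => (Ψ x : ℂ)) 2 volume) :
    Filter.Tendsto (fun k => ‖(h.memLp hΨ k).toLp _ - hΨ.toLp _‖) Filter.atTop (nhds 0) := by
  rw [← tendsto_iff_norm_sub_tendsto_zero, Lp.tendsto_Lp_iff_tendsto_eLpNorm'']
  have e : ∀ k, eLpNorm ((fun x => (g k x : ℂ)) - fun x => (Ψ x : ℂ)) 2 volume =
      (∫⁻ x, ENNReal.ofReal (Ψ x - g k x) ^ (2 : ℝ)) ^ (1 / 2 : ℝ) := by
    intro k
    rw [eLpNorm_eq_lintegral_rpow_enorm_toReal (by norm_num) (by norm_num)]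
    congr 1
    refine lintegral_congr fun x => ?_
    rw [Pi.sub_apply, ← Complex.ofReal_sub, ← ofReal_norm, Complex.norm_real, Real.norm_eq_abs,
      abs_sub_comm, abs_of_nonneg (sub_nonneg.2 (h.le k x))]
    rfl
  simp_rw [e]
  have hfin : ∫⁻ x, ENNReal.ofReal (Ψ x) ^ (2 : ℝ) ≠ ⊤ := by
    have h1 := (eLpNorm_lt_top_iff_lintegral_rpow_enorm_lt_top (by norm_num) (by norm_num)).1 hΨ.2
    refine ne_of_lt (lt_of_le_of_lt (lintegral_mono fun x => ?_) h1)
    rw [← ofReal_norm (Ψ x : ℂ), Complex.norm_real]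
    exact ENNReal.rpow_le_rpow (ENNReal.ofReal_le_ofReal (le_abs_self _)) (by norm_num)
  have hm : AEMeasurable Ψ volume :=
    (Complex.measurable_re.comp_aemeasurable hΨ.1.aemeasurable)
  have h2 : Filter.Tendsto (fun k => ∫⁻ x, ENNReal.ofReal (Ψ x - g k x) ^ (2 : ℝ)) Filter.atTop
      (nhds (∫⁻ _ : E, 0)) := by
    refine tendsto_lintegral_of_dominated_convergence' (fun x => ENNReal.ofReal (Ψ x) ^ (2 : ℝ))
      (fun k => ?_) (fun k => Filter.Eventually.of_forall fun x => ?_) hfin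
      (Filter.Eventually.of_forall fun x => ?_)
    · exact ((hm.sub (h.contDiff k).continuous.measurable.aemeasurable).ennreal_ofReal).pow_const _
    · exact ENNReal.rpow_le_rpow (ENNReal.ofReal_le_ofReal (by linarith [h.nonneg k x]))
        (by norm_num)
    · have h3 : Filter.Tendsto (fun k => Ψ x - g k x) Filter.atTop (nhds 0) := by
        simpa using (h.tendsto x).const_sub (Ψ x)
      have h4 := (ENNReal.continuous_rpow_const (y := 2)).tendsto _ |>.comp
        (ENNReal.tendsto_ofReal h3)
      simpa [Function.comp_def] using h4
  have h5 := (ENNReal.continuous_rpow_const (y := (1 / 2 : ℝ))).tendsto _ |>.comp h2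
  simpa [Function.comp_def] using h5

lemma IsExhaustion.tendsto_integral_mul {Ψ f : E → ℝ} {g : ℕ → E → ℝ} (h : IsExhaustion Ψ g)
    (hf : Integrable f) {C : ℝ} (hC : ∀ x, Ψ x ≤ C) :
    Filter.Tendsto (fun k => ∫ x, f x * g k x) Filter.atTop (nhds (∫ x, f x * Ψ x)) := by
  refine tendsto_integral_of_dominated_convergence (fun x => |f x| * C) (fun k => ?_)
    (hf.abs.mul_const C) (fun k => Filter.Eventually.of_forall fun x => ?_)
    (Filter.Eventually.of_forall fun x => (h.tendsto x).const_mul (f x))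
  · exact hf.aestronglyMeasurable.mul (h.contDiff k).continuous.aestronglyMeasurable
  · rw [Real.norm_eq_abs, abs_mul]
    exact mul_le_mul_of_nonneg_left ((h.abs_le k x).trans (hC x)) (abs_nonneg _)

end SpaceCutoff

/-! ### The weak formulation with separated variables -/

section TestedEquation

variable {n : ℕ} {σ δ p τ D₁ D₂ : ℝ} {T : EReal} {u : ℝ → L2 n} {η : ℝ → ℝ}

lemma IsTimeCutoff.deriv_eq_zero (hp : 0 < p) (hη : IsTimeCutoff p τ D₁ D₂ η) {t : ℝ}
    (ht : τ < |t|) : deriv η t = 0 := by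
  have := hη.deriv_le t
  rw [hη.eq_zero t ht, Real.zero_rpow (by positivity), mul_zero] at this
  exact abs_nonpos_iff.1 this

lemma IsTimeCutoff.iteratedDeriv_two_eq_zero (hp : 0 < p) (hη : IsTimeCutoff p τ D₁ D₂ η) {t : ℝ}
    (ht : τ < |t|) : iteratedDeriv 2 η t = 0 := by
  have := hη.iteratedDeriv_two_le t
  rw [hη.eq_zero t ht, Real.zero_rpow (by positivity), mul_zero] at this
  exact abs_nonpos_iff.1 this

/-- The `L²` function against which the space factor of a test function `η(t) g(x)` is integrated
in the weak formulation. -/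
noncomputable def weakDensity (σ δ : ℝ) (η : ℝ → ℝ) (u : ℝ → L2 n) (t : ℝ) : L2 n :=
  ((iteratedDeriv 2 η t : ℝ) : ℂ) • u t + (η t : ℂ) • fracLaplacian σ (u t)
    - ((deriv η t : ℝ) : ℂ) • fracLaplacian δ (u t)

lemma coeFn_weakDensity (σ δ : ℝ) (η : ℝ → ℝ) (u : ℝ → L2 n) (t : ℝ) :
    weakDensity σ δ η u t =ᵐ[volume] fun x => ((iteratedDeriv 2 η t : ℝ) : ℂ) * u t x +
      (η t : ℂ) * fracLaplacian σ (u t) x - ((deriv η t : ℝ) : ℂ) * fracLaplacian δ (u t) x := by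
  unfold weakDensity
  filter_upwards [Lp.coeFn_sub (((iteratedDeriv 2 η t : ℝ) : ℂ) • u t +
      (η t : ℂ) • fracLaplacian σ (u t)) (((deriv η t : ℝ) : ℂ) • fracLaplacian δ (u t)),
    Lp.coeFn_add (((iteratedDeriv 2 η t : ℝ) : ℂ) • u t) ((η t : ℂ) • fracLaplacian σ (u t)),
    Lp.coeFn_smul ((iteratedDeriv 2 η t : ℝ) : ℂ) (u t),
    Lp.coeFn_smul (η t : ℂ) (fracLaplacian σ (u t)),
    Lp.coeFn_smul ((deriv η t : ℝ) : ℂ) (fracLaplacian δ (u t))] with x h1 h2 h3 h4 h5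
  rw [h1, Pi.sub_apply, h2, Pi.add_apply, h3, h4, h5]
  simp

lemma timeDeriv_mul (η : ℝ → ℝ) (g : EuclideanSpace ℝ (Fin n) → ℝ) (hη : Differentiable ℝ η)
    (t : ℝ) (x : EuclideanSpace ℝ (Fin n)) :
    timeDeriv (fun z => η z.1 * g z.2) t x = deriv η t * g x := by
  simp only [timeDeriv]
  exact deriv_mul_const (hη t) _

lemma timeDeriv₂_mul (η : ℝ → ℝ) (g : EuclideanSpace ℝ (Fin n) → ℝ) (hη : Differentiable ℝ η)
    (hη' : Differentiable ℝ (deriv η)) (t : ℝ) (x : EuclideanSpace ℝ (Fin n)) :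
    timeDeriv₂ (fun z => η z.1 * g z.2) t x = iteratedDeriv 2 η t * g x := by
  simp only [timeDeriv₂]
  rw [iteratedDeriv_succ, iteratedDeriv_one, iteratedDeriv_succ, iteratedDeriv_one]
  have : deriv (fun s => η s * g x) = fun s => deriv η s * g x := by
    ext s
    exact deriv_mul_const (hη s) _
  rw [this]
  exact deriv_mul_const (hη' t) _

lemma isTestFunction_mul (hη : IsTimeCutoff p τ D₁ D₂ η) (hτ : (τ : EReal) < T)
    {g : EuclideanSpace ℝ (Fin n) → ℝ} (hg : ContDiff ℝ ∞ g) (hgc : HasCompactSupport g) :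
    IsTestFunction T fun z : ℝ × EuclideanSpace ℝ (Fin n) => η z.1 * g z.2 := by
  have hsupp : tsupport (fun z : ℝ × EuclideanSpace ℝ (Fin n) => η z.1 * g z.2) ⊆
      Set.Icc (-τ) τ ×ˢ tsupport g := by
    refine closure_minimal (fun z hz => ?_) (isClosed_Icc.prod (isClosed_tsupport g))
    have hz' := mul_ne_zero_iff.1 hz
    refine ⟨abs_le.1 ?_, subset_tsupport g hz'.2⟩
    by_contra h
    exact hz'.1 (hη.eq_zero _ (not_le.1 h))
  refine ⟨(hη.contDiff.comp contDiff_fst).mul (hg.comp contDiff_snd), ?_, fun z hz => ?_⟩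
  · exact (isCompact_Icc.prod hgc).of_isClosed_subset (isClosed_tsupport _) hsupp
  · exact (EReal.coe_le_coe_iff.2 (hsupp hz).1.2).trans_lt hτ

lemma integral_tested_eq (hη : ContDiff ℝ ∞ η) (g : EuclideanSpace ℝ (Fin n) → ℝ) (t : ℝ) :
    ∫ x, (u t x * (timeDeriv₂ (fun z => η z.1 * g z.2) t x : ℂ)
        + fracLaplacian σ (u t) x * ((η t * g x : ℝ) : ℂ)
        - fracLaplacian δ (u t) x * (timeDeriv (fun z => η z.1 * g z.2) t x : ℂ)) =
      ∫ x, weakDensity σ δ η u t x * (g x : ℂ) := by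
  have h1 : Differentiable ℝ η := hη.differentiable (by simp)
  have h2 : Differentiable ℝ (deriv η) :=
    (contDiff_infty_iff_deriv.1 hη).2.differentiable (by simp)
  refine integral_congr_ae ?_
  filter_upwards [coeFn_weakDensity σ δ η u t] with x hx
  rw [hx, timeDeriv_mul η g h1, timeDeriv₂_mul η g h1 h2]
  push_cast
  ring

/-- The space-time integral of `|u|^p η(t) g(x)` over `(0, τ] × ℝⁿ`. -/
noncomputable def powerIntegral (p τ : ℝ) (η : ℝ → ℝ) (g : EuclideanSpace ℝ (Fin n) → ℝ)
    (u : ℝ → L2 n) : ENNReal :=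
  ∫⁻ t in Set.Ioc 0 τ, ENNReal.ofReal (η t) * ∫⁻ x, ‖u t x‖ₑ ^ p * ENNReal.ofReal (g x)

lemma IsSobolevSolution.aemeasurable_power {u₀ : L2 n} {u₁ : EuclideanSpace ℝ (Fin n) → ℂ}
    (h : IsSobolevSolution σ δ p T u₀ u₁ u) (hσ : 0 ≤ σ) (hη : IsTimeCutoff p τ D₁ D₂ η)
    (hτ : (τ : EReal) < T) {g : EuclideanSpace ℝ (Fin n) → ℝ} (hg : Measurable g) :
    AEMeasurable (fun t => ENNReal.ofReal (η t) * ∫⁻ x, ‖u t x‖ₑ ^ p * ENNReal.ofReal (g x))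
      (volume.restrict (Set.Ioc 0 τ)) := by
  refine AEMeasurable.mul ?_ ?_
  · exact hη.contDiff.continuous.measurable.ennreal_ofReal.aemeasurable
  · exact aemeasurable_lintegral_enorm_rpow_mul hg measurableSet_Ioc
      ((h.continuous_sobolev.continuousOn (by linarith)).mono
        (Set.Ioc_subset_Icc_self.trans (Icc_subset_timeInterval hτ)))

lemma IsSobolevSolution.powerIntegral_lt_top {u₀ : L2 n} {u₁ : EuclideanSpace ℝ (Fin n) → ℂ}
    (h : IsSobolevSolution σ δ p T u₀ u₁ u) (hη : IsTimeCutoff p τ D₁ D₂ η)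
    (hτ : (τ : EReal) < T) {g : EuclideanSpace ℝ (Fin n) → ℝ} (hg : Continuous g)
    (hgc : HasCompactSupport g) : powerIntegral p τ η g u < ⊤ := by
  obtain ⟨G, hG⟩ := hgc.exists_bound_of_continuous hg
  have hK := h.locallyIntegrable_power τ (tsupport g) hτ hgc
  calc powerIntegral p τ η g u ≤ ∫⁻ t in Set.Ioc 0 τ,
        ENNReal.ofReal G * ∫⁻ x in tsupport g, ‖u t x‖ₑ ^ p := by
        refine lintegral_mono fun t => ?_
        refine (mul_le_of_le_one_left' (ENNReal.ofReal_le_one.2 (hη.le_one t))).trans ?_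
        rw [← lintegral_const_mul' _ _ ENNReal.ofReal_ne_top,
          ← lintegral_indicator (isClosed_tsupport g).measurableSet]
        refine lintegral_mono fun x => ?_
        by_cases hx : x ∈ tsupport g
        · rw [Set.indicator_of_mem hx, mul_comm]
          exact mul_le_mul_left (ENNReal.ofReal_le_ofReal ((le_abs_self _).trans (hG x))) _
        · simp [image_eq_zero_of_notMem_tsupport hx]
    _ = ENNReal.ofReal G * ∫⁻ t in Set.Ioc 0 τ, ∫⁻ x in tsupport g, ‖u t x‖ₑ ^ p :=
        lintegral_const_mul' _ _ ENNReal.ofReal_ne_top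
    _ ≤ ENNReal.ofReal G * ∫⁻ t in Set.Icc 0 τ, ∫⁻ x in tsupport g, ‖u t x‖ₑ ^ p :=
        mul_le_mul_right (lintegral_mono_set Set.Ioc_subset_Icc_self) _
    _ < ⊤ := ENNReal.mul_lt_top ENNReal.ofReal_lt_top hK

lemma IsSobolevSolution.integral_power_eq {u₀ : L2 n} {u₁ : EuclideanSpace ℝ (Fin n) → ℂ}
    (h : IsSobolevSolution σ δ p T u₀ u₁ u) (hσ : 0 ≤ σ) (hp : 0 < p)
    (hη : IsTimeCutoff p τ D₁ D₂ η) (hτ : (τ : EReal) < T)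
    {g : EuclideanSpace ℝ (Fin n) → ℝ} (hg : Continuous g) (hgc : HasCompactSupport g)
    (hg0 : ∀ x, 0 ≤ g x) :
    ∫ t in Set.Ioi (0 : ℝ), ∫ x, ((‖u t x‖ ^ p * (η t * g x) : ℝ) : ℂ) =
      ((powerIntegral p τ η g u).toReal : ℂ) := by
  have hm := h.aemeasurable_power hσ hη hτ hg.measurable
  have hP := h.powerIntegral_lt_top hη hτ hg hgc
  simp_rw [integral_complex_ofReal]
  congr 1
  have h1 : ∀ t, ∫ x, ‖u t x‖ ^ p * (η t * g x) =
      (ENNReal.ofReal (η t) * ∫⁻ x, ‖u t x‖ₑ ^ p * ENNReal.ofReal (g x)).toReal := by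
    intro t
    rw [integral_eq_lintegral_of_nonneg_ae (Filter.Eventually.of_forall fun x => mul_nonneg
      (by positivity) (mul_nonneg (hη.nonneg t) (hg0 x)))
      (((Lp.aestronglyMeasurable (u t)).norm.aemeasurable.pow_const p).aestronglyMeasurable.mul
        (hg.const_mul _).aestronglyMeasurable),
      ← lintegral_const_mul' _ _ ENNReal.ofReal_ne_top]
    congr 1
    refine lintegral_congr fun x => ?_
    rw [ENNReal.ofReal_mul (by positivity), ENNReal.ofReal_mul (hη.nonneg t),
      ← ENNReal.ofReal_rpow_of_nonneg (norm_nonneg _) hp.le, ofReal_norm]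
    ring
  simp_rw [h1]
  rw [setIntegral_eq_of_subset_of_forall_sdiff_eq_zero measurableSet_Ioi
    (Set.Ioc_subset_Ioi_self : Set.Ioc 0 τ ⊆ Set.Ioi 0), powerIntegral]
  · exact integral_toReal hm (ae_lt_top' hm hP.ne)
  · intro t ht
    have ht' : τ < |t| := by
      have h2 : 0 < t := ht.1
      have h3 : ¬ t ≤ τ := fun h3 => ht.2 ⟨h2, h3⟩
      rw [abs_of_pos h2]
      exact not_le.1 h3
    simp [hη.eq_zero t ht']

/-- The weak formulation tested with the product `η(t) g(x)`. -/
lemma IsSobolevSolution.ofReal_powerIntegral_add_le {f : EuclideanSpace ℝ (Fin n) → ℝ}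
    (h : IsSobolevSolution σ δ p T 0 (fun x => (f x : ℂ)) u) (hσ : 0 ≤ σ) (hp : 0 < p)
    (hη : IsTimeCutoff p τ D₁ D₂ η) (hτ : (τ : EReal) < T)
    {g : EuclideanSpace ℝ (Fin n) → ℝ} (hg : ContDiff ℝ ∞ g) (hgc : HasCompactSupport g)
    (hg0 : ∀ x, 0 ≤ g x) :
    ENNReal.ofReal ((powerIntegral p τ η g u).toReal + ∫ x, f x * g x) ≤
      ∫⁻ t in Set.Ioc 0 τ, ‖∫ x, weakDensity σ δ η u t x * (g x : ℂ)‖ₑ := by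
  have heq := h.equation _ (isTestFunction_mul hη hτ hg hgc)
  simp only [integral_tested_eq hη.contDiff g] at heq
  rw [h.integral_power_eq hσ hp hη hτ hg.continuous hgc hg0] at heq
  have hdata : ∫ x, (f x : ℂ) * ((η 0 * g x : ℝ) : ℂ) = ((∫ x, f x * g x : ℝ) : ℂ) := by
    rw [← integral_complex_ofReal, hη.apply_zero]
    simp
  have hzero : ∫ x, (fracLaplacian δ (0 : L2 n) x * ((η 0 * g x : ℝ) : ℂ) -
      (0 : L2 n) x * (timeDeriv (fun z => η z.1 * g z.2) 0 x : ℂ)) = 0 := by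
    rw [fracLaplacian_zero]
    refine integral_eq_zero_of_ae ?_
    filter_upwards [Lp.coeFn_zero ℂ 2 (volume : Measure (EuclideanSpace ℝ (Fin n)))] with x hx
    rw [hx]
    simp
  rw [hdata, hzero, add_zero, ← Complex.ofReal_add] at heq
  rw [setIntegral_eq_of_subset_of_forall_sdiff_eq_zero measurableSet_Ioi
    (Set.Ioc_subset_Ioi_self : Set.Ioc 0 τ ⊆ Set.Ioi 0)] at heq
  · calc _ ≤ ‖(((powerIntegral p τ η g u).toReal + ∫ x, f x * g x : ℝ) : ℂ)‖ₑ := by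
          rw [← ofReal_norm, Complex.norm_real]
          exact ENNReal.ofReal_le_ofReal (le_abs_self _)
      _ ≤ _ := by
          rw [← heq]
          -- This inequality needs no measurability in t of `weakDensity`, so only bounds on the
          -- fractional Laplacians of `u t` are ever used.
          exact enorm_integral_le_lintegral_enorm _
  · intro t ht
    have ht' : τ < |t| := by
      have h2 : 0 < t := ht.1
      have h3 : ¬ t ≤ τ := fun h3 => ht.2 ⟨h2, h3⟩
      rw [abs_of_pos h2]
      exact not_le.1 h3
    refine integral_eq_zero_of_ae ?_
    filter_upwards [coeFn_weakDensity σ δ η u t] with x hx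
    rw [hx, hη.eq_zero t ht', hη.deriv_eq_zero hp ht', hη.iteratedDeriv_two_eq_zero hp ht']
    simp

/-- Purely qualitative: the bound depends on u and serves to make the limit in the space cutoff
legitimate. The order zero case of the Sobolev bound controls u itself. -/
lemma IsSobolevSolution.exists_norm_weakDensity_le {u₀ : L2 n} {u₁ : EuclideanSpace ℝ (Fin n) → ℂ}
    (h : IsSobolevSolution σ δ p T u₀ u₁ u) (hσ : 0 ≤ σ) (hδ : 0 ≤ δ) (hδσ : δ ≤ σ) (hp : 0 < p)
    (hD₁ : 0 ≤ D₁) (hD₂ : 0 ≤ D₂) (hη : IsTimeCutoff p τ D₁ D₂ η) (hτ : (τ : EReal) < T) :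
    ∃ B : ℝ, 0 ≤ B ∧ ∀ t ∈ Set.Ioc 0 τ, ‖weakDensity σ δ η u t‖ ≤ B := by
  obtain ⟨B₀, hB₀, h₀⟩ := h.continuous_sobolev.exists_norm_fracLaplacian_le le_rfl
    (by linarith : 2 * (0 : ℝ) ≤ 2 * σ) hτ
  obtain ⟨B₁, hB₁, h₁⟩ := h.continuous_sobolev.exists_norm_fracLaplacian_le hσ le_rfl hτ
  obtain ⟨B₂, hB₂, h₂⟩ := h.continuous_sobolev.exists_norm_fracLaplacian_le hδ
    (by linarith : 2 * δ ≤ 2 * σ) hτ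
  simp only [fracLaplacian_zero_left] at h₀
  refine ⟨D₂ * B₀ + B₁ + D₁ * B₂, by positivity, fun t ht => ?_⟩
  have ht' := Set.Ioc_subset_Icc_self ht
  have hη1 : η t ^ (1 / p) ≤ 1 := Real.rpow_le_one (hη.nonneg t) (hη.le_one t) (by positivity)
  have e1 : |deriv η t| ≤ D₁ := (hη.deriv_le t).trans (mul_le_of_le_one_right hD₁ hη1)
  have e2 : |iteratedDeriv 2 η t| ≤ D₂ :=
    (hη.iteratedDeriv_two_le t).trans (mul_le_of_le_one_right hD₂ hη1)
  have e3 : |η t| ≤ 1 := by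
    rw [abs_of_nonneg (hη.nonneg t)]
    exact hη.le_one t
  unfold weakDensity
  refine (norm_sub_le _ _).trans (add_le_add ((norm_add_le _ _).trans (add_le_add ?_ ?_)) ?_)
  · rw [norm_smul, Complex.norm_real, Real.norm_eq_abs]
    exact mul_le_mul e2 (h₀ t ht') (norm_nonneg _) hD₂
  · rw [norm_smul, Complex.norm_real, Real.norm_eq_abs]
    exact (mul_le_of_le_one_left (norm_nonneg _) e3).trans (h₁ t ht')
  · rw [norm_smul, Complex.norm_real, Real.norm_eq_abs]
    exact mul_le_mul e1 (h₂ t ht') (norm_nonneg _) hD₁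

lemma tendsto_powerIntegral {Ψ : EuclideanSpace ℝ (Fin n) → ℝ}
    {g : ℕ → EuclideanSpace ℝ (Fin n) → ℝ} (hg : IsExhaustion Ψ g) {u₀ : L2 n}
    {u₁ : EuclideanSpace ℝ (Fin n) → ℂ} (h : IsSobolevSolution σ δ p T u₀ u₁ u) (hσ : 0 ≤ σ)
    (hp : 0 ≤ p) (hη : IsTimeCutoff p τ D₁ D₂ η) (hτ : (τ : EReal) < T) :
    Filter.Tendsto (fun k => powerIntegral p τ η (g k) u) Filter.atTop
      (nhds (powerIntegral p τ η Ψ u)) := by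
  have hmono : ∀ t, Monotone fun k => ∫⁻ x, ‖u t x‖ₑ ^ p * ENNReal.ofReal (g k x) :=
    fun t k l hkl => lintegral_mono fun x =>
      mul_le_mul_right (ENNReal.ofReal_le_ofReal (hg.mono x hkl)) _
  refine lintegral_tendsto_of_tendsto_of_monotone
    (fun k => h.aemeasurable_power hσ hη hτ (hg.contDiff k).continuous.measurable)
    (Filter.Eventually.of_forall fun t k l hkl => mul_le_mul_right (hmono t hkl) _)
    (Filter.Eventually.of_forall fun t => ?_)
  refine ENNReal.Tendsto.const_mul ?_ (Or.inr ENNReal.ofReal_ne_top)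
  refine lintegral_tendsto_of_tendsto_of_monotone (fun k => ?_)
    (Filter.Eventually.of_forall fun x k l hkl =>
      mul_le_mul_right (ENNReal.ofReal_le_ofReal (hg.mono x hkl)) _)
    (Filter.Eventually.of_forall fun x => ?_)
  · exact ((Lp.aestronglyMeasurable _).enorm.pow_const p).mul
      (hg.contDiff k).continuous.measurable.ennreal_ofReal.aemeasurable
  · exact ENNReal.Tendsto.const_mul (ENNReal.tendsto_ofReal (hg.tendsto x))
      (Or.inr (ENNReal.rpow_ne_top_of_nonneg hp enorm_ne_top))

end TestedEquation

/-! ### Absorbing the nonlinearity -/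

section DataBound

variable {n : ℕ} {σ δ p q τ D₁ D₂ : ℝ} {T : EReal} {u : ℝ → L2 n} {η : ℝ → ℝ}

/-- All three time factors are bounded by multiples of `η^(1/p)`: the derivatives by the choice of
cutoff, and η itself because `0 ≤ η ≤ 1 ≤ p`. -/
lemma enorm_integral_weakDensity_mul_le (hη : IsTimeCutoff p τ D₁ D₂ η) (hp : 1 ≤ p)
    (hD₁ : 0 ≤ D₁) (hD₂ : 0 ≤ D₂) {Ψ : EuclideanSpace ℝ (Fin n) → ℝ}
    (hΨ0 : ∀ x, 0 ≤ Ψ x) (hΨ : MemLp (fun x => (Ψ x : ℂ)) 2 volume) {cσ cδ : ℝ} (hcσ : 0 ≤ cσ)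
    (hcδ : 0 ≤ cδ) {t : ℝ}
    (h₁ : ‖∫ x, fracLaplacian σ (u t) x * (Ψ x : ℂ)‖ₑ ≤
      ENNReal.ofReal cσ * ∫⁻ x, ‖u t x‖ₑ * ENNReal.ofReal (Ψ x))
    (h₂ : ‖∫ x, fracLaplacian δ (u t) x * (Ψ x : ℂ)‖ₑ ≤
      ENNReal.ofReal cδ * ∫⁻ x, ‖u t x‖ₑ * ENNReal.ofReal (Ψ x)) :
    ‖∫ x, weakDensity σ δ η u t x * (Ψ x : ℂ)‖ₑ ≤
      ENNReal.ofReal ((D₂ + cσ + D₁ * cδ) * η t ^ (1 / p)) *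
        ∫⁻ x, ‖u t x‖ₑ * ENNReal.ofReal (Ψ x) := by
  have h₀ := enorm_integral_mul_ofReal_le (u t) hΨ0
  set X := ∫⁻ x, ‖u t x‖ₑ * ENNReal.ofReal (Ψ x) with hX
  have hη0 : 0 ≤ η t ^ (1 / p) := Real.rpow_nonneg (hη.nonneg t) _
  have hη1 : η t ≤ η t ^ (1 / p) := by
    have := Real.rpow_le_rpow_of_exponent_ge' (hη.nonneg t) (hη.le_one t)
      (show 0 ≤ 1 / p by positivity) (show 1 / p ≤ 1 by
        rw [div_le_one (by linarith)]; exact hp)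
    simpa using this
  have hterm : ∀ (a b c : ℝ) (z : ℂ), 0 ≤ b → |a| ≤ b → ‖z‖ₑ ≤ ENNReal.ofReal c * X →
      ‖(a : ℂ) * z‖ₑ ≤ ENNReal.ofReal (b * c) * X := by
    intro a b c z hb hab hz
    rw [enorm_mul, ← ofReal_norm (a : ℂ), Complex.norm_real, Real.norm_eq_abs,
      ENNReal.ofReal_mul hb, mul_assoc]
    exact mul_le_mul' (ENNReal.ofReal_le_ofReal hab) hz
  rw [integral_mul_ofReal_eq_inner hΨ] at h₀ h₁ h₂ ⊢
  unfold weakDensity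
  rw [inner_sub_right, inner_add_right, inner_smul_right, inner_smul_right, inner_smul_right]
  refine enorm_sub_le.trans ((add_le_add_left (enorm_add_le _ _) _).trans ?_)
  refine (add_le_add (add_le_add
    (hterm _ _ 1 _ (by positivity) (hη.iteratedDeriv_two_le t) (by simpa using h₀))
    (hterm _ (η t ^ (1 / p)) cσ _ hη0 (by rwa [abs_of_nonneg (hη.nonneg t)]) h₁))
    (hterm _ _ cδ _ (by positivity) (hη.deriv_le t) h₂)).trans (le_of_eq ?_)
  rw [← add_mul, ← add_mul, ← ENNReal.ofReal_add (by positivity) (by positivity),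
    ← ENNReal.ofReal_add (by positivity) (by positivity)]
  congr 2
  ring

/-- The nonlinear test function estimate: the pairing of the data with a positive test function
`Ψ` is bounded in terms of the sizes of `(-Δ)^σ Ψ` and `(-Δ)^δ Ψ` relative to `Ψ`. -/
theorem IsSobolevSolution.integral_data_mul_le {f : EuclideanSpace ℝ (Fin n) → ℝ}
    (h : IsSobolevSolution σ δ p T 0 (fun x => (f x : ℂ)) u) (hf : Integrable f) (hσ : 0 ≤ σ)
    (hδ : 0 ≤ δ) (hδσ : δ ≤ σ) (hpq : p.HolderConjugate q) (hD₁ : 0 ≤ D₁) (hD₂ : 0 ≤ D₂)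
    (hη : IsTimeCutoff p τ D₁ D₂ η) (hτ0 : 0 ≤ τ) (hτ : (τ : EReal) < T)
    {Ψ : EuclideanSpace ℝ (Fin n) → ℝ} (hΨs : ContDiff ℝ ∞ Ψ) (hΨ0 : ∀ x, 0 ≤ Ψ x) {C : ℝ}
    (hΨC : ∀ x, Ψ x ≤ C) (hΨi : Integrable Ψ) {cσ cδ : ℝ} (hcσ : 0 ≤ cσ) (hcδ : 0 ≤ cδ)
    (hσΨ : ∀ v : L2 n, MemLp (fracSymbolMul σ v) 2 volume →
      ‖∫ x, fracLaplacian σ v x * (Ψ x : ℂ)‖ₑ ≤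
        ENNReal.ofReal cσ * ∫⁻ x, ‖v x‖ₑ * ENNReal.ofReal (Ψ x))
    (hδΨ : ∀ v : L2 n, MemLp (fracSymbolMul δ v) 2 volume →
      ‖∫ x, fracLaplacian δ v x * (Ψ x : ℂ)‖ₑ ≤
        ENNReal.ofReal cδ * ∫⁻ x, ‖v x‖ₑ * ENNReal.ofReal (Ψ x)) :
    ∫ x, f x * Ψ x ≤ (D₂ + cσ + D₁ * cδ) ^ q * (∫ x, Ψ x) * τ := by
  have hp0 : 0 < p := hpq.pos
  set K : ℝ := D₂ + cσ + D₁ * cδ with hK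
  have hK0 : 0 ≤ K := by positivity
  have hΨ : MemLp (fun x => (Ψ x : ℂ)) 2 volume := hΨi.memLp_two_of_bound (C := C) fun x => by
    rw [abs_of_nonneg (hΨ0 x)]
    exact hΨC x
  obtain ⟨g, hg⟩ := exists_isExhaustion hΨs hΨ0
  obtain ⟨B, hB0, hB⟩ := h.exists_norm_weakDensity_le hσ hδ hδσ hp0 hD₁ hD₂ hη hτ
  set G : L2 n := hΨ.toLp _ with hG
  set b : ℕ → ℝ := fun k => ‖(hg.memLp hΨ k).toLp _ - G‖ with hb
  have hb' : Filter.Tendsto b Filter.atTop (nhds 0) := hg.tendsto_norm_toLp_sub hΨ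
  have hb0 : ∀ k, 0 ≤ b k := fun k => norm_nonneg _
  set P := powerIntegral p τ η Ψ u with hP
  have hPk := fun k => h.powerIntegral_lt_top hη hτ (hg.contDiff k).continuous
    (hg.hasCompactSupport k)
  have hPlim : Filter.Tendsto (fun k => powerIntegral p τ η (g k) u) Filter.atTop (nhds P) :=
    tendsto_powerIntegral hg h hσ hp0.le hη hτ
  have hS := hg.tendsto_integral_mul hf hΨC
  have hweak := fun k => h.ofReal_powerIntegral_add_le hσ hp0 hη hτ (hg.contDiff k)
    (hg.hasCompactSupport k) (hg.nonneg k)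
  -- The sharp bound holds for Ψ, not for its cutoffs. The difference is an error that tends to zero
  -- uniformly in t because the cutoffs converge in L².
  have hinner : ∀ k t, ∫ x, weakDensity σ δ η u t x * (g k x : ℂ) =
      inner ℂ G (weakDensity σ δ η u t) +
        inner ℂ ((hg.memLp hΨ k).toLp _ - G) (weakDensity σ δ η u t) := by
    intro k t
    rw [integral_mul_ofReal_eq_inner (hg.memLp hΨ k), ← inner_add_left, add_sub_cancel]
  have hdiff : ∀ k, ∀ t ∈ Set.Ioc 0 τ,
      ‖(inner ℂ ((hg.memLp hΨ k).toLp _ - G) (weakDensity σ δ η u t) : ℂ)‖ₑ ≤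
        ENNReal.ofReal (b k * B) := by
    intro k t ht
    rw [← ofReal_norm]
    exact ENNReal.ofReal_le_ofReal ((norm_inner_le_norm _ _).trans
      (mul_le_mul_of_nonneg_left (hB t ht) (norm_nonneg _)))
  have hvol : volume (Set.Ioc 0 τ) = ENNReal.ofReal τ := by simp
  have hcrude : ∀ k, (powerIntegral p τ η (g k) u).toReal ≤
      (‖G‖ * B + b k * B) * τ - ∫ x, f x * g k x := by
    intro k
    have h1 : ∫⁻ t in Set.Ioc 0 τ, ‖∫ x, weakDensity σ δ η u t x * (g k x : ℂ)‖ₑ ≤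
        ENNReal.ofReal ((‖G‖ * B + b k * B) * τ) := by
      calc _ ≤ ∫⁻ _ in Set.Ioc 0 τ, ENNReal.ofReal (‖G‖ * B + b k * B) := by
            refine setLIntegral_mono' measurableSet_Ioc fun t ht => ?_
            rw [hinner, ENNReal.ofReal_add (by positivity) (mul_nonneg (hb0 k) hB0)]
            refine (enorm_add_le _ _).trans (add_le_add ?_ (hdiff k t ht))
            rw [← ofReal_norm]
            exact ENNReal.ofReal_le_ofReal ((norm_inner_le_norm _ _).trans
              (mul_le_mul_of_nonneg_left (hB t ht) (norm_nonneg _)))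
        _ = _ := by
            rw [setLIntegral_const, hvol, ← ENNReal.ofReal_mul (add_nonneg (by positivity)
              (mul_nonneg (hb0 k) hB0))]
    have h2 := (ENNReal.ofReal_le_ofReal_iff (mul_nonneg (add_nonneg (by positivity)
      (mul_nonneg (hb0 k) hB0)) hτ0)).1 ((hweak k).trans h1)
    linarith
  -- Finiteness has to come before the sharp estimate, in which P appears on both sides and is
  -- subtracted.
  have hPfin : P < ⊤ := by
    have h1 : Filter.Tendsto (fun k => ENNReal.ofReal
        ((‖G‖ * B + b k * B) * τ - ∫ x, f x * g k x)) Filter.atTop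
        (nhds (ENNReal.ofReal ((‖G‖ * B + 0 * B) * τ - ∫ x, f x * Ψ x))) :=
      ENNReal.tendsto_ofReal ((((hb'.mul_const B).const_add _).mul_const τ).sub hS)
    refine lt_of_le_of_lt (le_of_tendsto_of_tendsto' hPlim h1 fun k => ?_) ENNReal.ofReal_lt_top
    rw [← ENNReal.ofReal_toReal (hPk k).ne]
    exact ENNReal.ofReal_le_ofReal (hcrude k)
  have hΨint : 0 ≤ ∫ x, Ψ x := integral_nonneg hΨ0
  have hfine : ∀ k, (powerIntegral p τ η (g k) u).toReal + ∫ x, f x * g k x ≤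
      P.toReal + (K ^ q * (∫ x, Ψ x) + b k * B) * τ := by
    intro k
    have hc0 : 0 ≤ K ^ q * (∫ x, Ψ x) + b k * B :=
      add_nonneg (by positivity) (mul_nonneg (hb0 k) hB0)
    have h1 : ∫⁻ t in Set.Ioc 0 τ, ‖∫ x, weakDensity σ δ η u t x * (g k x : ℂ)‖ₑ ≤
        ENNReal.ofReal (P.toReal + (K ^ q * (∫ x, Ψ x) + b k * B) * τ) := by
      calc _ ≤ ∫⁻ t in Set.Ioc 0 τ, ((ENNReal.ofReal (η t) *
            ∫⁻ x, ‖u t x‖ₑ ^ p * ENNReal.ofReal (Ψ x)) +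
            ENNReal.ofReal (K ^ q * (∫ x, Ψ x) + b k * B)) := by
            refine setLIntegral_mono' measurableSet_Ioc fun t ht => ?_
            have ht' := Icc_subset_timeInterval hτ (Set.Ioc_subset_Icc_self ht)
            rw [hinner, ENNReal.ofReal_add (by positivity) (mul_nonneg (hb0 k) hB0), ← add_assoc]
            refine (enorm_add_le _ _).trans (add_le_add ?_ (hdiff k t ht))
            rw [← integral_mul_ofReal_eq_inner hΨ]
            refine (enorm_integral_weakDensity_mul_le hη hpq.lt.le hD₁ hD₂ hΨ0 hΨ hcσ hcδ
              (hσΨ _ (h.continuous_sobolev.memLp_fracSymbolMul hσ le_rfl ht'))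
              (hδΨ _ (h.continuous_sobolev.memLp_fracSymbolMul hδ (by linarith) ht'))).trans ?_
            rw [← lintegral_const_mul' _ _ ENNReal.ofReal_ne_top,
              ← lintegral_const_mul' _ _ ENNReal.ofReal_ne_top,
              ENNReal.ofReal_mul (p := K ^ q) (by positivity), ofReal_integral_eq_lintegral_ofReal hΨi
                (Filter.Eventually.of_forall hΨ0),
              ← lintegral_const_mul' _ _ ENNReal.ofReal_ne_top, ← lintegral_add_right]
            · refine lintegral_mono fun x => ?_
              calc _ = (ENNReal.ofReal (K * η t ^ (1 / p)) * ‖u t x‖ₑ) *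
                    ENNReal.ofReal (Ψ x) := by ring
                _ ≤ (‖u t x‖ₑ ^ p * ENNReal.ofReal (η t) + ENNReal.ofReal (K ^ q)) *
                    ENNReal.ofReal (Ψ x) :=
                  mul_le_mul_left (ENNReal.mul_ofReal_le_rpow_mul_add hpq _ (hη.nonneg t) hK0) _
                _ = _ := by ring
            · exact hΨs.continuous.measurable.ennreal_ofReal.const_mul _
        _ = P + ENNReal.ofReal ((K ^ q * (∫ x, Ψ x) + b k * B) * τ) := by
            rw [lintegral_add_right _ measurable_const, setLIntegral_const, hvol,
              ← ENNReal.ofReal_mul hc0, hP, powerIntegral]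
        _ = _ := by
            rw [ENNReal.ofReal_add ENNReal.toReal_nonneg (mul_nonneg hc0 hτ0),
              ENNReal.ofReal_toReal hPfin.ne]
    exact (ENNReal.ofReal_le_ofReal_iff (add_nonneg ENNReal.toReal_nonneg
      (mul_nonneg hc0 hτ0))).1 ((hweak k).trans h1)
  -- As k grows the error vanishes and both sides contain `P.toReal`, which cancels.
  have hlim := le_of_tendsto_of_tendsto'
    (((ENNReal.tendsto_toReal hPfin.ne).comp hPlim).add hS)
    ((((hb'.mul_const B).const_add (K ^ q * ∫ x, Ψ x)).mul_const τ).const_add P.toReal) hfine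
  rw [zero_mul, add_zero] at hlim
  linarith

end DataBound

/-! ### Scaling and the lifespan bound -/

section Lifespan

variable {n : ℕ} {σ δ p : ℝ}

lemma kMinus_nonneg (hσ : 0 ≤ σ) (hδ : 0 ≤ δ) : 0 ≤ kMinus σ δ := le_min hσ (by linarith)

/-- The weight must be integrable, yet decay no faster than the kernel of either nonlocal operator.
The slower kernel is that of order δ, unless δ = 0, when the damping is local and only σ matters. -/
lemma exists_weight_exponent (n : ℕ) (hσ : 0 < σ) (hδ : 0 ≤ δ) (hδσ : δ ≤ σ) :
    ∃ q : ℝ, (n : ℝ) < q ∧ q ≤ n + 2 * σ ∧ (δ ≠ 0 → q ≤ n + 2 * δ) := by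
  rcases hδ.eq_or_lt with rfl | h
  · exact ⟨n + 2 * σ, by linarith, le_rfl, fun h => absurd rfl h⟩
  · exact ⟨n + 2 * δ, by linarith, by linarith, fun _ => le_rfl⟩

/-- Testing with the dilated weight at spatial scale `R` and time scale `R ^ (2σ - k⁻)`. -/
theorem exists_integral_data_mul_le (hn : n ≠ 0) (hσ : 0 < σ) (hδ : 0 ≤ δ) (hδσ : δ ≤ σ)
    {q : ℝ} (hpq : p.HolderConjugate q) :
    ∃ ψ : EuclideanSpace ℝ (Fin n) → ℝ, Continuous ψ ∧ (∀ x, 0 < ψ x) ∧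
      (∃ C, ∀ x, ψ x ≤ C) ∧ ∃ N : ℝ, 0 ≤ N ∧
      ∀ (f : EuclideanSpace ℝ (Fin n) → ℝ) (T : EReal) (u : ℝ → L2 n), Integrable f →
        IsSobolevSolution σ δ p T 0 (fun x => (f x : ℂ)) u →
        ∀ R : ℝ, 1 ≤ R → ((R ^ (2 * σ - kMinus σ δ) : ℝ) : EReal) < T →
          ∫ x, f x * ψ (R⁻¹ • x) ≤ N * R ^ (n + (2 * σ - kMinus σ δ) - 2 * σ * q) := by
  obtain ⟨r, hr, hrσ, hrδ⟩ := exists_weight_exponent n hσ hδ hδσ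
  have hr0 : 0 ≤ r := (Nat.cast_nonneg n).trans hr.le
  obtain ⟨ψ, hψ⟩ := exists_isSmoothWeight (E := EuclideanSpace ℝ (Fin n)) hr0
  obtain ⟨Cσ, hCσ, hσψ⟩ := hψ.enorm_integral_fracLaplacian_mul_le hn hσ.le hr fun _ => hrσ
  obtain ⟨Cδ, hCδ, hδψ⟩ := hψ.enorm_integral_fracLaplacian_mul_le hn hδ hr hrδ
  obtain ⟨Cη, hCη, hη⟩ := exists_isTimeCutoff hpq.lt
  have hψi : Integrable ψ := hψ.integrable (by simpa using hr)
  set A : ℝ := Cη + Cσ + Cη * Cδ with hA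
  have hA0 : 0 ≤ A := by positivity
  have hI : 0 ≤ ∫ x, ψ x := integral_nonneg fun x => (hψ.pos x).le
  refine ⟨ψ, hψ.contDiff.continuous, hψ.pos, ⟨2 ^ r, hψ.le_two_rpow hr0⟩, A ^ q * ∫ x, ψ x,
    by positivity, fun f T u hf h R hR hRT => ?_⟩
  have hR0 : 0 < R := by linarith
  set α : ℝ := 2 * σ - kMinus σ δ with hα
  have hkσ : kMinus σ δ ≤ σ := min_le_left _ _
  have hkδ : kMinus σ δ ≤ 2 * δ := min_le_right _ _
  set τ : ℝ := R ^ α with hτ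
  have hτ0 : 0 < τ := Real.rpow_pos_of_pos hR0 _
  obtain ⟨η, hη'⟩ := hη τ hτ0
  have hψRi : Integrable fun x => ψ (R⁻¹ • x) :=
    (integrable_comp_smul_iff volume ψ (inv_ne_zero hR0.ne')).2 hψi
  have key := h.integral_data_mul_le hf hσ.le hδ hδσ hpq (by positivity) (by positivity) hη' hτ0.le
    hRT (Ψ := fun x => ψ (R⁻¹ • x)) (hψ.contDiff.comp (contDiff_const_smul _))
    (fun x => (hψ.pos _).le) (fun x => hψ.le_two_rpow hr0 _) hψRi
    (cσ := Cσ * R ^ (-(2 * σ))) (cδ := Cδ * R ^ (-(2 * δ))) (by positivity) (by positivity)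
    (hσψ R hR0) (hδψ R hR0)
  have hτinv : τ⁻¹ = R ^ (-α) := by rw [hτ, Real.rpow_neg hR0.le]
  -- This is where the definition of `k⁻` enters: `k⁻ ≤ σ` makes `τ^(-2)`, and `k⁻ ≤ 2δ` makes
  -- `τ^(-1) R^(-2δ)`, at most `R^(-2σ)` for `R ≥ 1`.
  have hK : Cη * τ⁻¹ ^ 2 + Cσ * R ^ (-(2 * σ)) + Cη * τ⁻¹ * (Cδ * R ^ (-(2 * δ))) ≤
      A * R ^ (-(2 * σ)) := by
    have e1 : τ⁻¹ ^ 2 ≤ R ^ (-(2 * σ)) := by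
      rw [hτinv, ← Real.rpow_natCast, ← Real.rpow_mul hR0.le]
      refine Real.rpow_le_rpow_of_exponent_le hR ?_
      push_cast
      linarith
    have e2 : τ⁻¹ * R ^ (-(2 * δ)) ≤ R ^ (-(2 * σ)) := by
      rw [hτinv, ← Real.rpow_add hR0]
      exact Real.rpow_le_rpow_of_exponent_le hR (by linarith)
    calc _ = Cη * τ⁻¹ ^ 2 + Cσ * R ^ (-(2 * σ)) + Cη * Cδ * (τ⁻¹ * R ^ (-(2 * δ))) := by ring
      _ ≤ Cη * R ^ (-(2 * σ)) + Cσ * R ^ (-(2 * σ)) + Cη * Cδ * R ^ (-(2 * σ)) := by gcongr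
      _ = _ := by rw [hA]; ring
  have hint : ∫ x, ψ (R⁻¹ • x) = R ^ (n : ℝ) * ∫ x, ψ x := by
    rw [Measure.integral_comp_smul, smul_eq_mul, finrank_euclideanSpace_fin, inv_pow, inv_inv,
      abs_of_pos (by positivity), Real.rpow_natCast]
  calc _ ≤ _ := key
    _ ≤ (A * R ^ (-(2 * σ))) ^ q * (R ^ (n : ℝ) * ∫ x, ψ x) * τ := by
        rw [hint]
        refine mul_le_mul_of_nonneg_right (mul_le_mul_of_nonneg_right ?_ (by positivity)) hτ0.le
        exact Real.rpow_le_rpow (by positivity) hK hpq.symm.nonneg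
    _ = A ^ q * (∫ x, ψ x) * ((R ^ (-(2 * σ))) ^ q * R ^ (n : ℝ) * R ^ α) := by
        rw [Real.mul_rpow hA0 (by positivity)]
        ring
    _ = _ := by
        rw [← Real.rpow_mul hR0.le, ← Real.rpow_add hR0, ← Real.rpow_add hR0]
        ring_nf

lemma tendsto_integral_mul_dilate {E : Type*} [NormedAddCommGroup E] [NormedSpace ℝ E]
    [MeasurableSpace E] [BorelSpace E] [SecondCountableTopology E] {μ : Measure E} {f ψ : E → ℝ}
    (hf : Integrable f μ) (hψ : Continuous ψ) {C : ℝ} (hC : ∀ x, |ψ x| ≤ C) :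
    Filter.Tendsto (fun R : ℝ => ∫ x, f x * ψ (R⁻¹ • x) ∂μ) Filter.atTop
      (nhds ((∫ x, f x ∂μ) * ψ 0)) := by
  rw [← integral_mul_const]
  refine tendsto_integral_filter_of_dominated_convergence (fun x => |f x| * C)
    (Filter.Eventually.of_forall fun R => ?_) (Filter.Eventually.of_forall fun R =>
      Filter.Eventually.of_forall fun x => ?_) (hf.abs.mul_const C)
    (Filter.Eventually.of_forall fun x => ?_)
  · exact hf.aestronglyMeasurable.mul
      (hψ.comp (continuous_const_smul (T := E) R⁻¹)).aestronglyMeasurable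
  · rw [Real.norm_eq_abs, abs_mul]
    exact mul_le_mul_of_nonneg_left (hC _) (abs_nonneg _)
  · refine Filter.Tendsto.const_mul _ ((hψ.tendsto 0).comp (f := fun R : ℝ => R⁻¹ • x) ?_)
    simpa using (tendsto_inv_atTop_zero (𝕜 := ℝ)).smul_const x

/-- Upper bound for the existence time of a Sobolev solution with small data. -/
theorem exists_existenceTime_le (hσ : 0 < σ) (hδ : 0 ≤ δ) (hδσ : δ ≤ σ)
    (hn : 2 * kMinus σ δ < (n : ℝ)) (hp₁ : 1 < p)
    (hp : p < 1 + 2 * σ / ((n : ℝ) - kMinus σ δ)) {u₁ : EuclideanSpace ℝ (Fin n) → ℝ}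
    (hu₁ : Integrable u₁) (hpos : 0 < ∫ x, u₁ x) :
    ∃ C : ℝ, 0 < C ∧ ∀ ε : ℝ, 0 < ε → ε ≤ 1 → ∀ (T : EReal) (u : ℝ → L2 n),
      IsSobolevSolution σ δ p T 0 (fun x => ((ε * u₁ x : ℝ) : ℂ)) u →
      T ≤ ((C * ε ^ (-((2 * σ - kMinus σ δ) * (p - 1)
          / (2 * σ - ((n : ℝ) - kMinus σ δ) * (p - 1)))) : ℝ) : EReal) := by
  have hk0 := kMinus_nonneg hσ.le hδ
  have hkσ : kMinus σ δ ≤ σ := min_le_left _ _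
  have hn0 : n ≠ 0 := by
    rintro rfl
    simp only [Nat.cast_zero] at hn
    linarith
  have hpq : p.HolderConjugate p.conjExponent := Real.HolderConjugate.conjExponent hp₁
  set k := kMinus σ δ with hk
  set α : ℝ := 2 * σ - k with hα
  have hα0 : 0 < α := by linarith
  have hD : 0 < 2 * σ - ((n : ℝ) - k) * (p - 1) := by
    have h1 : p - 1 < 2 * σ / ((n : ℝ) - k) := by linarith
    rw [lt_div_iff₀ (by linarith)] at h1
    linarith
  set D : ℝ := 2 * σ - ((n : ℝ) - k) * (p - 1) with hDdef
  have hp0 : 0 < p - 1 := by linarith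
  -- The decay rate of the data bound is `R^(-D/(p - 1)) = τ^(-1/κ)` when `τ = R^α`, so κ is the
  -- lifespan exponent.
  set κ : ℝ := α * (p - 1) / D with hκ
  have hκ0 : 0 < κ := by positivity
  obtain ⟨ψ, hψc, hψ0, ⟨C, hC⟩, N, hN, hest⟩ := exists_integral_data_mul_le hn0 hσ hδ hδσ hpq
  have hexp : (n : ℝ) + (2 * σ - k) - 2 * σ * p.conjExponent = -(α * κ⁻¹) := by
    have hακ : α * κ⁻¹ = D / (p - 1) := by
      rw [hκ]
      field_simp
    rw [hακ, Real.conjExponent, hDdef]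
    field_simp
    ring
  set c : ℝ := (∫ x, u₁ x) * ψ 0 / 2 with hc
  have hc0 : 0 < c := by have := hψ0 0; positivity
  have hev : ∀ᶠ R : ℝ in Filter.atTop, c ≤ ∫ x, u₁ x * ψ (R⁻¹ • x) := by
    have h1 := tendsto_integral_mul_dilate hu₁ hψc (C := C) fun x => by
      rw [abs_of_pos (hψ0 x)]
      exact hC x
    exact (h1.eventually_const_lt (show c < (∫ x, u₁ x) * ψ 0 by
      have := mul_pos hpos (hψ0 0)
      rw [hc]
      linarith)).mono fun _ h => h.le
  obtain ⟨R₀, hR₀⟩ := Filter.eventually_atTop.1 hev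
  set R₁ := max R₀ 1 with hR₁
  have hR₁0 : 0 < R₁ := lt_of_lt_of_le one_pos (le_max_right _ _)
  -- The first summand forces `R ≥ R₁`, since `ε^(-κ) ≥ 1` for `ε ≤ 1`. The second matches the bound
  -- `τ ≤ (N/c)^κ ε^(-κ)` derived below, and the surplus `R₁^α ε^(-κ) > 0` yields the contradiction.
  refine ⟨R₁ ^ α + (N / c) ^ κ, by positivity, fun ε hε hε1 T u h => ?_⟩
  by_contra hT
  rw [not_le] at hT
  set τ : ℝ := (R₁ ^ α + (N / c) ^ κ) * ε ^ (-κ) with hτ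
  have hεκ : 1 ≤ ε ^ (-κ) := Real.one_le_rpow_of_pos_of_le_one_of_nonpos hε hε1 (by linarith)
  have hτ0 : 0 < τ := by positivity
  set R : ℝ := τ ^ α⁻¹ with hR
  have hRα : R ^ α = τ := by rw [hR, ← Real.rpow_mul hτ0.le, inv_mul_cancel₀ hα0.ne', Real.rpow_one]
  have hR₁R : R₁ ≤ R := by
    have h1 : R₁ ^ α ≤ τ := by
      have h2 : 0 ≤ (N / c) ^ κ := by positivity
      have h3 : 0 < R₁ ^ α := by positivity
      calc R₁ ^ α ≤ (R₁ ^ α + (N / c) ^ κ) * 1 := by linarith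
        _ ≤ _ := mul_le_mul_of_nonneg_left hεκ (by positivity)
    have h2 := Real.rpow_le_rpow (by positivity) h1 (inv_pos.2 hα0).le
    rwa [← Real.rpow_mul hR₁0.le, mul_inv_cancel₀ hα0.ne', Real.rpow_one] at h2
  have hR1 : 1 ≤ R := (le_max_right _ _).trans hR₁R
  have hmain := hest _ T u (hu₁.const_mul ε) h R hR1 (by rw [hRα]; exact hT)
  simp_rw [mul_assoc ε] at hmain
  rw [integral_const_mul, hexp, ← mul_neg, Real.rpow_mul (by linarith), hRα,
    Real.rpow_neg hτ0.le] at hmain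
  have hlow : ε * c ≤ N * (τ ^ κ⁻¹)⁻¹ :=
    (mul_le_mul_of_nonneg_left (hR₀ R ((le_max_left _ _).trans hR₁R)) hε.le).trans hmain
  have h1 : τ ^ κ⁻¹ ≤ N / c * ε⁻¹ := by
    have hpos' : 0 < τ ^ κ⁻¹ := by positivity
    rw [← div_eq_mul_inv, le_div_iff₀ hpos'] at hlow
    rw [← div_eq_mul_inv, div_div, le_div_iff₀ (by positivity)]
    linarith
  have h2 : τ ≤ (N / c) ^ κ * ε ^ (-κ) := by
    have h3 := Real.rpow_le_rpow (by positivity) h1 hκ0.le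
    rwa [← Real.rpow_mul hτ0.le, inv_mul_cancel₀ hκ0.ne', Real.rpow_one,
      Real.mul_rpow (by positivity) (by positivity), Real.inv_rpow hε.le, ← Real.rpow_neg hε.le]
      at h3
  have h4 : 0 < R₁ ^ α * ε ^ (-κ) := by positivity
  rw [hτ, add_mul] at h2
  linarith

end Lifespan

theorem theorem1p2 (n : ℕ) (σ δ p : ℝ) (hσ : 1 ≤ σ) (hδ₀ : 0 ≤ δ) (hδσ : δ < σ)
    (hn : 2 * kMinus σ δ < (n : ℝ))
    (hp₁ : 1 < p) (hp : p < 1 + 2 * σ / ((n : ℝ) - kMinus σ δ))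
    (u₁ : EuclideanSpace ℝ (Fin n) → ℝ) (hu₁ : Integrable u₁ volume) (hpos : 0 < ∫ x, u₁ x) :
    (¬ ∃ u : ℝ → L2 n, IsSobolevSolution σ δ p ⊤ 0 (fun x => (u₁ x : ℂ)) u) ∧
    ∃ C : ℝ, 0 < C ∧ ∃ ε₀ : ℝ, 0 < ε₀ ∧ ∀ ε : ℝ, 0 < ε → ε ≤ ε₀ →
      lifespan σ δ p (0 : L2 n) (fun x => ((ε * u₁ x : ℝ) : ℂ)) ≤
        ((C * ε ^ (-((2 * σ - kMinus σ δ) * (p - 1)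
          / (2 * σ - ((n : ℝ) - kMinus σ δ) * (p - 1)))) : ℝ) : EReal) := by
  obtain ⟨C, hC, h⟩ := exists_existenceTime_le (by linarith) hδ₀ hδσ.le hn hp₁ hp hu₁ hpos
  refine ⟨fun ⟨u, hu⟩ => ?_, C, hC, 1, one_pos, fun ε hε hε1 => ?_⟩
  -- A global solution would be a solution with `T = ⊤` for `ε = 1`, against a finite bound.
  · have h1 := h 1 one_pos le_rfl ⊤ u (by simpa using hu)
    exact (EReal.coe_lt_top _).not_ge h1
  · exact sSup_le fun T ⟨u, hu⟩ => h ε hε hε1 T u hu
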